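/- Let $E$ be a reflexive Banach space (over $\mathbb{R}$ or $\mathbb{C}$) with the approximation property, i.e. for every compact $C \subset E$ and every $\varepsilon > 0$ there is a bounded finite rank operator $S$ on $E$ with $\|Sx - x\| \leq \varepsilon$ for all $x \in C$. For a normed space $X$ let $\mathcal{K}(X)$ denote the algebra of compact linear operators on $X$ with the operator norm. For a normed algebra $\mathfrak{A}$ let $\mathcal{E}\ell(\mathfrak{A})$ denote the algebra (under composition) of all elementary operators on $\mathfrak{A}$, i.e. of all linear operators $T$ on $\mathfrak{A}$ for which there are $a_1, b_1, \ldots, a_n, b_n \in \mathfrak{A}$ such that $Tx = \sum_{j=1}^n a_j x b_j$ for all $x \in \mathfrak{A}$; such operators are bounded. Then $\mathcal{E}\ell(\mathcal{K}(E))$ is a norm dense subalgebra of $\mathcal{K}(\mathcal{K}(E))$; that is, every elementary operator on $\mathcal{K}(E)$ is a compact operator on the Banach space $\mathcal{K}(E)$, and every compact operator on $\mathcal{K}(E)$ is a limit, in operator norm, of elementary operators on $\mathcal{K}(E)$. -/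

import Mathlib

/-- A normed space is reflexive if the canonical map into its bidual is onto. -/
def IsReflexiveSpace (𝕜 E : Type*) [RCLike 𝕜] [NormedAddCommGroup E] [NormedSpace 𝕜 E] : Prop :=
  Function.Surjective (NormedSpace.inclusionInDoubleDual 𝕜 E)

/-- The approximation property: the identity can be approximated, uniformly on compact sets,
by bounded finite rank operators. -/
def HasApproximationProperty (𝕜 E : Type*) [RCLike 𝕜] [NormedAddCommGroup E]
    [NormedSpace 𝕜 E] : Prop :=
  ∀ C : Set E, IsCompact C → ∀ ε : ℝ, 0 < ε →
    ∃ S : E →L[𝕜] E, FiniteDimensional 𝕜 (LinearMap.range (S : E →ₗ[𝕜] E)) ∧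
      ∀ x ∈ C, ‖S x - x‖ ≤ ε

/-- The compact operators on `E`, as a subalgebra of the algebra of all bounded operators. -/
def compactOps (𝕜 E : Type*) [RCLike 𝕜] [NormedAddCommGroup E] [NormedSpace 𝕜 E] :
    NonUnitalSubalgebra 𝕜 (E →L[𝕜] E) where
  carrier := {T | IsCompactOperator T}
  zero_mem' := isCompactOperator_zero
  add_mem' := fun hS hT => hS.add hT
  smul_mem' := fun c _ hT => hT.smul c
  mul_mem' := fun {_ T} hS _ => hS.comp_clm T

/-- `𝒦(E)`: the normed algebra of compact operators on `E`, with the operator norm. It is the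
subalgebra `compactOps 𝕜 E`, made into a type of its own. -/
def CompactAlg (𝕜 E : Type*) [RCLike 𝕜] [NormedAddCommGroup E] [NormedSpace 𝕜 E] : Type _ :=
  {T : E →L[𝕜] E // T ∈ compactOps 𝕜 E}

namespace CompactAlg

variable {𝕜 E : Type*} [RCLike 𝕜] [NormedAddCommGroup E] [NormedSpace 𝕜 E]

/-- The bounded operator underlying an element of `𝒦(E)`. -/
def toCLM (T : CompactAlg 𝕜 E) : E →L[𝕜] E := Subtype.val T

noncomputable instance : NonUnitalNormedRing (CompactAlg 𝕜 E) :=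
  inferInstanceAs (NonUnitalNormedRing (compactOps 𝕜 E))

noncomputable instance : NormedSpace 𝕜 (CompactAlg 𝕜 E) where
  toModule := inferInstanceAs (Module 𝕜 (compactOps 𝕜 E))
  norm_smul_le c T := norm_smul_le c T.toCLM

instance : IsScalarTower 𝕜 (CompactAlg 𝕜 E) (CompactAlg 𝕜 E) :=
  inferInstanceAs (IsScalarTower 𝕜 (compactOps 𝕜 E) (compactOps 𝕜 E))

instance : SMulCommClass 𝕜 (CompactAlg 𝕜 E) (CompactAlg 𝕜 E) :=
  inferInstanceAs (SMulCommClass 𝕜 (compactOps 𝕜 E) (compactOps 𝕜 E))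

theorem norm_def (T : CompactAlg 𝕜 E) : ‖T‖ = ‖T.toCLM‖ := rfl

theorem toCLM_mul (S T : CompactAlg 𝕜 E) : (S * T).toCLM = S.toCLM ∘L T.toCLM := rfl

theorem toCLM_add (S T : CompactAlg 𝕜 E) : (S + T).toCLM = S.toCLM + T.toCLM := rfl

theorem toCLM_smul (c : 𝕜) (T : CompactAlg 𝕜 E) : (c • T).toCLM = c • T.toCLM := rfl

end CompactAlg

section Elementary

variable (𝕜 A : Type*) [RCLike 𝕜] [NonUnitalNormedRing A] [NormedSpace 𝕜 A]

/-- An elementary operator: `x ↦ ∑ⱼ aⱼ x bⱼ` for finitely many `aⱼ, bⱼ` in the algebra. -/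
def IsElementary {𝕜 A : Type*} [RCLike 𝕜] [NonUnitalNormedRing A] [NormedSpace 𝕜 A]
    (T : A →ₗ[𝕜] A) : Prop :=
  ∃ (n : ℕ) (a b : Fin n → A), ∀ x : A, T x = ∑ j, a j * x * b j

/-- `ℰℓ(A)`, the algebra (under composition) of all elementary operators on `A`, all of which
are bounded. -/
def elementaryOps [IsScalarTower 𝕜 A A] [SMulCommClass 𝕜 A A] :
    NonUnitalSubalgebra 𝕜 (A →L[𝕜] A) where
  carrier := {T | IsElementary (T : A →ₗ[𝕜] A)}
  zero_mem' := ⟨0, Fin.elim0, Fin.elim0, fun x => by simp⟩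
  add_mem' := by
    rintro S T ⟨m, a, b, hS⟩ ⟨n, c, d, hT⟩
    refine ⟨m + n, Fin.append a c, Fin.append b d, fun x => ?_⟩
    have h1 := hS x
    have h2 := hT x
    simp only [ContinuousLinearMap.coe_coe] at h1 h2
    simp [Fin.sum_univ_add, h1, h2]
  smul_mem' := by
    rintro r T ⟨n, a, b, hT⟩
    refine ⟨n, fun j => r • a j, b, fun x => ?_⟩
    have h1 := hT x
    simp only [ContinuousLinearMap.coe_coe] at h1
    simp [h1, Finset.smul_sum, smul_mul_assoc]
  mul_mem' := by
    rintro S T ⟨m, a, b, hS⟩ ⟨n, c, d, hT⟩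
    refine ⟨m * n, fun k => a (finProdFinEquiv.symm k).1 * c (finProdFinEquiv.symm k).2,
      fun k => d (finProdFinEquiv.symm k).2 * b (finProdFinEquiv.symm k).1, fun x => ?_⟩
    have h1 := hS (T x)
    have h2 := hT x
    simp only [ContinuousLinearMap.coe_coe] at h1 h2
    rw [Equiv.sum_comp finProdFinEquiv.symm
      (fun p : Fin m × Fin n => a p.1 * c p.2 * x * (d p.2 * b p.1)), Fintype.sum_prod_type]
    simp only [ContinuousLinearMap.coe_coe, mul_apply_eq_comp, h1]
    simp only [h2, Finset.mul_sum, Finset.sum_mul, mul_assoc]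

/-- Every elementary operator is bounded, so that passing to continuous operators in
`elementaryOps` loses nothing. -/
theorem IsElementary.continuous {𝕜 A : Type*} [RCLike 𝕜] [NonUnitalNormedRing A]
    [NormedSpace 𝕜 A] {T : A →ₗ[𝕜] A} (hT : IsElementary T) : Continuous T := by
  obtain ⟨n, a, b, h⟩ := hT
  have : (T : A → A) = fun x => ∑ j, a j * x * b j := funext h
  rw [this]
  fun_prop

end Elementary

/-! The hinge is the identity (f ⊗ y) x (g ⊗ z) = f(xz) · (g ⊗ y), `mulLeftRight_rankOne`: two-sided
multiplication by rank one operators is a rank one operator on 𝒦(E). By the approximation property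
the finite rank operators are dense in 𝒦(E), so every x ↦ axb is a norm limit of finite rank
operators, hence compact.

Conversely, let T be compact. On the compact closure of the image of the unit ball, x is uniformly
close to SxR for suitable finite rank S and R (`exists_mul_mul_sub_le`). Here S comes straight from
the approximation property, while R needs adjoints that approximate the identity on compact subsets
of E*; reflexivity and a duality argument on null families provide them (`exists_adj_sub_le`). So T
is close to x ↦ S(Tx)R, a finite sum of operators φ ⊗ u with u of rank one and φ a functional on
𝒦(E). It remains to approximate φ in norm by combinations of the functionals x ↦ f(xz)
(`dense_coeffSpan`).

If that failed, a gliding hump would give finite rank xₙ in the unit ball with φ(xₙ) = ε and xₙ → 0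
in the weak operator topology (`exists_seq_tendsto_weakly_zero`). As continuous functions on the
product of the weak* compact balls of E** and E*, the xₙ tend to zero pointwise, by reflexivity.
Mazur's lemma then yields convex combinations of small norm on which φ is still ε, a contradiction.
-/

open Filter Topology

/-! ### Mazur's lemma on a compact space -/

/-- A version of Mazur's lemma: a bounded sequence of nonnegative continuous functions on a compact
space that tends to zero pointwise has uniformly small convex combinations. -/
theorem exists_mem_convexHull_forall_lt {K : Type*} [TopologicalSpace K] [CompactSpace K]
    [T2Space K] (F : ℕ → C(K, ℝ)) (h0 : ∀ n k, 0 ≤ F n k) {C : ℝ} (hC : ∀ n k, F n k ≤ C)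
    (hlim : ∀ k, Tendsto (fun n => F n k) atTop (𝓝 0)) {δ : ℝ} (hδ : 0 < δ) :
    ∃ g ∈ convexHull ℝ (Set.range F), ∀ k, g k < δ := by
  by_contra! h
  have hopen : IsOpen {g : C(K, ℝ) | ∀ k, g k < δ} := by
    have := ContinuousMap.isOpen_setOfPred_mapsTo (X := K) (Y := ℝ) isCompact_univ
      (isOpen_Iio (a := δ))
    simpa [Set.MapsTo] using this
  have hconv : Convex ℝ {g : C(K, ℝ) | ∀ k, g k < δ} := by
    intro f hf g hg a b ha hb hab k
    exact convex_Iio δ (hf k) (hg k) ha hb hab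
  obtain ⟨Λ, u, h1, h2⟩ := geometric_hahn_banach_open hconv hopen (convex_convexHull ℝ (Set.range F))
    (Set.disjoint_left.2 fun g hg hg' => by
      obtain ⟨k, hk⟩ := h g hg'
      exact absurd (hg k) (not_lt.2 hk))
  have hu : 0 < u := by simpa using h1 0 (fun k => by simpa using hδ)
  have hpos : ∀ g : C(K, ℝ), (∀ k, 0 ≤ g k) → 0 ≤ Λ g := by
    intro g hg
    by_contra! hneg
    -- The factor `u / Λ g` is nonpositive, so this multiple of `g` lies below `δ`, yet `Λ` takes
    -- the forbidden value `u` on it.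
    have := h1 ((u / Λ g) • g) (fun k => by
      have : u / Λ g * g k ≤ 0 :=
        mul_nonpos_of_nonpos_of_nonneg (div_nonpos_of_nonneg_of_nonpos hu.le hneg.le) (hg k)
      simpa using this.trans_lt hδ)
    rw [map_smul, smul_eq_mul, div_mul_cancel₀ _ hneg.ne] at this
    exact lt_irrefl _ this
  -- The separating functional is positive, hence integration against a finite measure. Dominated
  -- convergence then sends `Λ (F n)` to zero, although separation keeps it at least `u > 0`.
  let Λ' : CompactlySupportedContinuousMap K ℝ →ₚ[ℝ] ℝ := PositiveLinearMap.mk₀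
    { toFun := fun f => Λ f.toContinuousMap
      map_add' := fun f g => map_add Λ f.toContinuousMap g.toContinuousMap
      map_smul' := fun c f => map_smul Λ c f.toContinuousMap } (fun f hf => hpos _ fun k => hf k)
  let _ : MeasurableSpace K := borel K
  have : BorelSpace K := ⟨rfl⟩
  have hint : ∀ n, ∫ k, F n k ∂(RealRMK.rieszMeasure Λ') = Λ (F n) := fun n =>
    RealRMK.integral_rieszMeasure Λ' (CompactlySupportedContinuousMap.continuousMapEquiv (F n))
  have hten : Tendsto (fun n => Λ (F n)) atTop (𝓝 0) := by
    have := MeasureTheory.tendsto_integral_of_dominated_convergence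
      (μ := RealRMK.rieszMeasure Λ') (F := fun n k => F n k) (f := fun _ => (0 : ℝ)) (fun _ => C)
      (fun n => (F n).continuous.aestronglyMeasurable) (MeasureTheory.integrable_const C)
      (fun n => Eventually.of_forall fun k => by
        rw [Real.norm_of_nonneg (h0 n k)]; exact hC n k)
      (Eventually.of_forall hlim)
    simpa [hint] using this
  exact absurd (ge_of_tendsto' hten fun n => h2 _ (subset_convexHull ℝ _ ⟨n, rfl⟩)) (not_le.2 hu)

/-! ### Norming sets and weak* null sequences -/

section Duality

variable {𝕜 : Type*} [RCLike 𝕜] {X : Type*} [NormedAddCommGroup X] [NormedSpace 𝕜 X]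

theorem exists_dual_ne_zero_of_notMem_closure (p : Submodule 𝕜 X) {x : X}
    (hx : x ∉ closure (p : Set X)) :
    ∃ f : StrongDual 𝕜 X, (∀ y ∈ p, f y = 0) ∧ f x ≠ 0 := by
  rw [← Submodule.topologicalClosure_coe, SetLike.mem_coe] at hx
  have : IsClosed (p.topologicalClosure : Set X) := p.isClosed_topologicalClosure
  obtain ⟨g, hg⟩ := SeparatingDual.exists_ne_zero (R := 𝕜) (x := p.topologicalClosure.mkQ x)
    (by simpa using hx)
  refine ⟨g.comp p.topologicalClosure.mkQL, fun y hy => ?_, by simpa using hg⟩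
  have : p.topologicalClosure.mkQ y = 0 := by simpa using p.le_topologicalClosure hy
  simpa using congrArg g this

/-- `Z` norms `G`, up to a factor `2`. -/
def IsNorming (Z : Set X) (G : Set (StrongDual 𝕜 X)) : Prop :=
  ∀ g ∈ G, ∃ z ∈ Z, ‖z‖ ≤ 1 ∧ ‖g‖ ≤ 2 * ‖g z‖

/-- If `g'` in `G` is near `g`, then ‖g'‖ ≤ 2‖g' z‖ = 2‖(g' - g) z‖, so ‖g‖ ≤ 3‖g - g'‖. -/
theorem IsNorming.eq_zero_of_mem_closure {Z : Set X} {G : Set (StrongDual 𝕜 X)}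
    (h : IsNorming Z G) {g : StrongDual 𝕜 X} (hg : g ∈ closure G) (hz : ∀ z ∈ Z, g z = 0) :
    g = 0 := by
  rw [← norm_le_zero_iff]
  refine le_of_forall_pos_le_add fun ε hε => ?_
  obtain ⟨g', hg', hd⟩ := Metric.mem_closure_iff.1 hg (ε / 3) (by positivity)
  obtain ⟨z, hzZ, hz1, hn⟩ := h g' hg'
  rw [dist_eq_norm] at hd
  have h1 : ‖g' z‖ ≤ ‖g - g'‖ := by
    have := (g - g').le_opNorm_of_le hz1
    simpa [hz z hzZ] using this
  have h2 : ‖g‖ ≤ ‖g'‖ + ‖g - g'‖ := by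
    simpa using norm_add_le g' (g - g')
  linarith

/-- The unit sphere of `G` is compact, and the open sets where a given unit ball vector takes a
value larger than 1/2 cover it. A finite subcover suffices, by homogeneity. -/
theorem exists_finite_isNorming {G : Submodule 𝕜 (StrongDual 𝕜 X)} (hG : G.FG) :
    ∃ Z : Set X, Z.Finite ∧ IsNorming Z (G : Set (StrongDual 𝕜 X)) := by
  have : FiniteDimensional 𝕜 G := Module.Finite.iff_fg.2 hG
  have : ProperSpace G := FiniteDimensional.proper 𝕜 G
  have hc : IsCompact (Metric.sphere (0 : G) 1) := isCompact_sphere 0 1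
  obtain ⟨t, ht⟩ := hc.elim_finite_subcover
    (fun z : {z : X // ‖z‖ ≤ 1} => {g : G | (1 / 2 : ℝ) < ‖(g : StrongDual 𝕜 X) z‖})
    (fun z => isOpen_lt continuous_const
      (((ContinuousLinearMap.apply 𝕜 𝕜 (z : X)).continuous.comp continuous_subtype_val).norm))
    (fun g hg => by
      have hg1 : ‖(g : StrongDual 𝕜 X)‖ = 1 := by
        have : dist (g : StrongDual 𝕜 X) 0 = 1 := hg
        rwa [dist_zero_right] at this
      obtain ⟨z, hz, hgz⟩ := (g : StrongDual 𝕜 X).exists_lt_apply_of_lt_opNorm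
        (r := 1 / 2) (by rw [hg1]; norm_num)
      exact Set.mem_iUnion.2 ⟨⟨z, hz.le⟩, hgz⟩)
  -- The extra vector 0 serves `g = 0`, which the cover of the sphere does not reach.
  refine ⟨insert 0 (Subtype.val '' (t : Set {z : X // ‖z‖ ≤ 1})),
    (t.finite_toSet.image _).insert _, fun g hg => ?_⟩
  by_cases h0 : g = 0
  · exact ⟨0, by simp, by simp, by simp [h0]⟩
  have hn : (0 : ℝ) < ‖g‖ := norm_pos_iff.2 h0
  let g' : G := ⟨((‖g‖⁻¹ : ℝ) : 𝕜) • g, G.smul_mem _ hg⟩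
  have hg' : g' ∈ Metric.sphere (0 : G) 1 := by
    change dist (((‖g‖⁻¹ : ℝ) : 𝕜) • g) 0 = 1
    rw [dist_zero_right, norm_smul, RCLike.norm_ofReal, abs_of_pos (inv_pos.2 hn), inv_mul_cancel₀ hn.ne']
  obtain ⟨z, hzt, hz⟩ := Set.mem_iUnion₂.1 (ht hg')
  refine ⟨z, Or.inr ⟨z, hzt, rfl⟩, z.2, ?_⟩
  have hz' : 1 / 2 < ‖((‖g‖⁻¹ : ℝ) : 𝕜) * g z‖ := hz
  rw [norm_mul, RCLike.norm_ofReal, abs_of_pos (inv_pos.2 hn), ← div_eq_inv_mul,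
    lt_div_iff₀ hn] at hz'
  linarith

/-- In a reflexive space, a bounded sequence of functionals that tends to zero on a set that norms
its span is weak* null. -/
theorem tendsto_zero_of_isNorming (hX : IsReflexiveSpace 𝕜 X) (h : ℕ → StrongDual 𝕜 X) {C : ℝ}
    (hC : ∀ n, ‖h n‖ ≤ C) {Z : Set X} {G : Submodule 𝕜 (StrongDual 𝕜 X)} (hG : ∀ n, h n ∈ G)
    (hZ : IsNorming Z (G : Set (StrongDual 𝕜 X)))
    (hlim : ∀ z ∈ Z, Tendsto (fun n => h n z) atTop (𝓝 0)) (x : X) :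
    Tendsto (fun n => h n x) atTop (𝓝 0) := by
  let V : Submodule 𝕜 X :=
    { carrier := {x | Tendsto (fun n => h n x) atTop (𝓝 0)}
      zero_mem' := by simp
      add_mem' := fun {a b} ha hb => by simpa using Tendsto.add ha hb
      smul_mem' := fun c a ha => by simpa using Tendsto.const_mul c ha }
  have hC0 : 0 ≤ C := (norm_nonneg _).trans (hC 0)
  have hcl : closure (V : Set X) ⊆ V := by
    intro y hy
    change Tendsto _ _ _
    rw [Metric.tendsto_atTop]
    intro ε hε
    obtain ⟨v, hv, hd⟩ := Metric.mem_closure_iff.1 hy (ε / (2 * (C + 1))) (by positivity)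
    obtain ⟨N, hN⟩ := Metric.tendsto_atTop.1 (show Tendsto (fun n => h n v) atTop (𝓝 0) from hv)
      (ε / 2) (by positivity)
    refine ⟨N, fun n hn => ?_⟩
    have h1 := hN n hn
    rw [dist_zero_right] at h1 ⊢
    rw [dist_eq_norm, lt_div_iff₀ (by positivity)] at hd
    have h2 : ‖h n (y - v)‖ ≤ C * ‖y - v‖ := (h n).le_of_opNorm_le (hC n) _
    have h3 : ‖h n y‖ ≤ ‖h n (y - v)‖ + ‖h n v‖ := by
      simpa using norm_add_le (h n (y - v)) (h n v)
    nlinarith [norm_nonneg (y - v)]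
  by_contra hx
  obtain ⟨g, hgV, hgx⟩ := exists_dual_ne_zero_of_notMem_closure V fun hx' => hx (hcl hx')
  -- Otherwise some element of the bidual kills `G` but not `g`. By reflexivity it is evaluation at
  -- a point `e`; all `h n` vanish at `e`, so `e` lies in `V`, where `g` is zero.
  have hgG : g ∈ closure (G : Set (StrongDual 𝕜 X)) := by
    by_contra hg
    obtain ⟨Φ, hΦ, hΦg⟩ := exists_dual_ne_zero_of_notMem_closure G hg
    obtain ⟨e, rfl⟩ := hX Φ
    simp only [NormedSpace.dual_def] at hΦ hΦg
    refine hΦg (hgV e ?_)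
    change Tendsto _ _ _
    simp [fun n => hΦ _ (hG n)]
  have : g = 0 := hZ.eq_zero_of_mem_closure hgG fun z hz => hgV z (hlim z hz)
  simp [this] at hgx

theorem IsReflexiveSpace.dual (hX : IsReflexiveSpace 𝕜 X) :
    IsReflexiveSpace 𝕜 (StrongDual 𝕜 X) := by
  intro Φ
  refine ⟨Φ.comp (NormedSpace.inclusionInDoubleDual 𝕜 X), ?_⟩
  ext ψ
  obtain ⟨e, rfl⟩ := hX ψ
  simp

end Duality

/-! ### Finite rank operators and coefficient functionals -/

namespace CompactAlg

variable {𝕜 E : Type*} [RCLike 𝕜] [NormedAddCommGroup E] [NormedSpace 𝕜 E]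

/-- The inclusion of `𝒦(E)` into the bounded operators, as a bounded linear map. -/
noncomputable def toCLML (𝕜 E : Type*) [RCLike 𝕜] [NormedAddCommGroup E] [NormedSpace 𝕜 E] :
    CompactAlg 𝕜 E →L[𝕜] E →L[𝕜] E :=
  LinearMap.mkContinuous ⟨⟨toCLM, toCLM_add⟩, toCLM_smul⟩ 1 fun T => by
    rw [one_mul]; exact (norm_def T).ge

@[simp]
theorem toCLML_apply (T : CompactAlg 𝕜 E) : toCLML 𝕜 E T = T.toCLM := rfl

theorem toCLM_injective : Function.Injective (toCLM : CompactAlg 𝕜 E → E →L[𝕜] E) :=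
  Subtype.val_injective

theorem isCompactOperator (T : CompactAlg 𝕜 E) : IsCompactOperator T.toCLM := T.2

theorem norm_apply_le (T : CompactAlg 𝕜 E) (z : E) : ‖T.toCLM z‖ ≤ ‖T‖ * ‖z‖ :=
  T.toCLM.le_opNorm z

/-- The operator `z ↦ f z • y`. -/
noncomputable def rankOne (f : StrongDual 𝕜 E) (y : E) : CompactAlg 𝕜 E :=
  ⟨f.smulRight y, by
    have h : IsCompactOperator (ContinuousLinearMap.toSpanSingleton 𝕜 y) :=
      isCompactOperator_of_locallyCompactSpace_rng _
    exact h.comp_clm f⟩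

@[simp]
theorem rankOne_apply (f : StrongDual 𝕜 E) (y z : E) : (rankOne f y).toCLM z = f z • y := rfl

/-- The finite rank operators. -/
noncomputable def finiteRankOps (𝕜 E : Type*) [RCLike 𝕜] [NormedAddCommGroup E] [NormedSpace 𝕜 E] :
    Submodule 𝕜 (CompactAlg 𝕜 E) :=
  Submodule.span 𝕜 (Set.range fun p : StrongDual 𝕜 E × E => rankOne p.1 p.2)

/-- The functional `x ↦ f (x z)` on `𝒦(E)`. -/
noncomputable def coeffFunctional (f : StrongDual 𝕜 E) (z : E) : StrongDual 𝕜 (CompactAlg 𝕜 E) :=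
  f.comp ((ContinuousLinearMap.apply 𝕜 E z).comp (toCLML 𝕜 E))

@[simp]
theorem coeffFunctional_apply (f : StrongDual 𝕜 E) (z : E) (x : CompactAlg 𝕜 E) :
    coeffFunctional f z x = f (x.toCLM z) := rfl

/-- The span of the functionals `x ↦ f (x z)`. -/
noncomputable def coeffSpan (𝕜 E : Type*) [RCLike 𝕜] [NormedAddCommGroup E] [NormedSpace 𝕜 E] :
    Submodule 𝕜 (StrongDual 𝕜 (CompactAlg 𝕜 E)) :=
  Submodule.span 𝕜 (Set.range fun p : StrongDual 𝕜 E × E => coeffFunctional p.1 p.2)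

/-- The value of the bidual of `x` at `Φ`, tested against `f`. -/
noncomputable def bidualCoeff (Φ : StrongDual 𝕜 (StrongDual 𝕜 E)) (f : StrongDual 𝕜 E) :
    StrongDual 𝕜 (CompactAlg 𝕜 E) :=
  Φ.comp ((ContinuousLinearMap.compL 𝕜 E E 𝕜 f).comp (toCLML 𝕜 E))

@[simp]
theorem bidualCoeff_apply (Φ : StrongDual 𝕜 (StrongDual 𝕜 E)) (f : StrongDual 𝕜 E)
    (x : CompactAlg 𝕜 E) : bidualCoeff Φ f x = Φ (f.comp x.toCLM) := rfl

theorem norm_bidualCoeff_apply_le (Φ : StrongDual 𝕜 (StrongDual 𝕜 E)) (f : StrongDual 𝕜 E)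
    (x : CompactAlg 𝕜 E) : ‖bidualCoeff Φ f x‖ ≤ ‖Φ‖ * (‖f‖ * ‖x‖) :=
  Φ.le_of_opNorm_le_of_le le_rfl (ContinuousLinearMap.opNorm_comp_le f x.toCLM)

/-- Joint continuity comes from finite rank: in rank one the function is a product of two weak*
continuous evaluations. -/
theorem continuous_bidualCoeff {x : CompactAlg 𝕜 E} (hx : x ∈ finiteRankOps 𝕜 E) :
    Continuous fun k : WeakDual 𝕜 (StrongDual 𝕜 E) × WeakDual 𝕜 E =>
      bidualCoeff (WeakDual.toStrongDual k.1) (WeakDual.toStrongDual k.2) x := by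
  induction hx using Submodule.span_induction with
  | mem x hx =>
    obtain ⟨⟨g, y⟩, rfl⟩ := hx
    have : (fun k : WeakDual 𝕜 (StrongDual 𝕜 E) × WeakDual 𝕜 E =>
        bidualCoeff (WeakDual.toStrongDual k.1) (WeakDual.toStrongDual k.2) (rankOne g y)) =
        fun k => k.2 y * k.1 g := by
      funext k
      have h : (WeakDual.toStrongDual k.2).comp (rankOne g y).toCLM = k.2 y • g := by
        ext z
        simp [mul_comm]
      rw [bidualCoeff_apply, h, map_smul, smul_eq_mul]
      rfl
    rw [this]
    exact ((WeakDual.eval_continuous y).comp continuous_snd).mul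
      ((WeakDual.eval_continuous g).comp continuous_fst)
  | zero => simpa only [map_zero] using continuous_const
  | add x y _ _ hx hy => simp only [map_add]; exact hx.add hy
  | smul c x _ hx => simp only [map_smul]; exact hx.const_smul c

/-- The range is recorded inside the bidual so that both spaces consist of functionals and
`exists_finite_isNorming` applies to each. -/
theorem exists_fg_submodules {x : CompactAlg 𝕜 E} (hx : x ∈ finiteRankOps 𝕜 E) :
    ∃ (G : Submodule 𝕜 (StrongDual 𝕜 (StrongDual 𝕜 E))) (H : Submodule 𝕜 (StrongDual 𝕜 E)),
      G.FG ∧ H.FG ∧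
      (∀ z, NormedSpace.inclusionInDoubleDual 𝕜 E (x.toCLM z) ∈ G) ∧
      ∀ f : StrongDual 𝕜 E, f.comp x.toCLM ∈ H := by
  induction hx using Submodule.span_induction with
  | mem x hx =>
    obtain ⟨⟨g, y⟩, rfl⟩ := hx
    refine ⟨Submodule.span 𝕜 {NormedSpace.inclusionInDoubleDual 𝕜 E y}, Submodule.span 𝕜 {g},
      Submodule.fg_span_singleton _, Submodule.fg_span_singleton _, fun z => ?_, fun f => ?_⟩
    · rw [rankOne_apply, map_smul]
      exact Submodule.smul_mem _ _ (Submodule.mem_span_singleton_self _)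
    · have h : f.comp (rankOne g y).toCLM = f y • g := by
        ext z
        simp [mul_comm]
      rw [h]
      exact Submodule.smul_mem _ _ (Submodule.mem_span_singleton_self _)
  | zero =>
    refine ⟨⊥, ⊥, Submodule.fg_bot, Submodule.fg_bot, fun z => ?_, fun f => ?_⟩
    · simp [show (0 : CompactAlg 𝕜 E).toCLM = 0 from rfl]
    · simp [show (0 : CompactAlg 𝕜 E).toCLM = 0 from rfl]
  | add x y _ _ hx hy =>
    obtain ⟨G, H, h1, h2, hG, hH⟩ := hx
    obtain ⟨G', H', h1', h2', hG', hH'⟩ := hy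
    refine ⟨G ⊔ G', H ⊔ H', h1.sup h1', h2.sup h2', fun z => ?_, fun f => ?_⟩
    · simpa [toCLM_add] using Submodule.add_mem_sup (hG z) (hG' z)
    · simpa [toCLM_add] using Submodule.add_mem_sup (hH f) (hH' f)
  | smul c x _ hx =>
    obtain ⟨G, H, h1, h2, hG, hH⟩ := hx
    refine ⟨G, H, h1, h2, fun z => ?_, fun f => ?_⟩
    · simpa [toCLM_smul] using G.smul_mem c (hG z)
    · simpa [toCLM_smul] using H.smul_mem c (hH f)

/-- Otherwise φ has norm at most ε on the finite rank operators killed by the finitely many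
functionals x ↦ f(xz). Subtracting a Hahn–Banach extension `ψ` of this restriction leaves a
functional that, on finite rank operators, is a combination of those functionals; so φ is within ε
of `coeffSpan` there. -/
theorem exists_mem_finiteRankOps_of_finite {φ : StrongDual 𝕜 (CompactAlg 𝕜 E)} {ε : ℝ}
    (hε : 0 < ε) (hφ : ∀ m ∈ coeffSpan 𝕜 E, ∃ x ∈ finiteRankOps 𝕜 E, ε * ‖x‖ < ‖φ x - m x‖)
    {D : Set (StrongDual 𝕜 E)} (hD : D.Finite) {Z : Set E} (hZ : Z.Finite) :
    ∃ x ∈ finiteRankOps 𝕜 E, ‖x‖ ≤ 1 ∧ φ x = (ε : 𝕜) ∧ ∀ f ∈ D, ∀ z ∈ Z, f (x.toCLM z) = 0 := by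
  by_contra! hno
  have hfin : Finite (D ×ˢ Z : Set _) := (hD.prod hZ)
  let L : (D ×ˢ Z : Set _) → StrongDual 𝕜 (CompactAlg 𝕜 E) :=
    fun p => coeffFunctional p.1.1 p.1.2
  let N : Submodule 𝕜 (CompactAlg 𝕜 E) := finiteRankOps 𝕜 E ⊓ ⨅ p, (L p).ker
  have hN : ∀ x ∈ N, ‖φ x‖ ≤ ε * ‖x‖ := by
    intro x hx
    by_contra! hlt
    obtain ⟨hxY, hx0⟩ := hx
    have hφx : 0 < ‖φ x‖ := lt_of_le_of_lt (by positivity) hlt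
    have hφx0 : φ x ≠ 0 := norm_pos_iff.1 hφx
    obtain ⟨f, hf, z, hz, hne⟩ := hno (((ε : 𝕜) / φ x) • x) (Submodule.smul_mem _ _ hxY)
      (by
        rw [norm_smul, norm_div, RCLike.norm_ofReal, abs_of_pos hε, div_mul_eq_mul_div,
          div_le_one hφx]
        exact hlt.le)
      (by rw [map_smul, smul_eq_mul, div_mul_cancel₀ _ hφx0])
    refine hne ?_
    have h0 : f (x.toCLM z) = 0 := by
      simpa [L] using (Submodule.mem_iInf _).1 hx0 ⟨(f, z), hf, hz⟩
    simp [toCLM_smul, h0]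
  obtain ⟨ψ, hψ, hψn⟩ := exists_extension_norm_eq N (φ.comp N.subtypeL)
  have hψε : ‖ψ‖ ≤ ε := by
    rw [hψn]
    exact ContinuousLinearMap.opNorm_le_bound _ hε.le fun x => hN x x.2
  let Y := finiteRankOps 𝕜 E
  have hspan : ((φ - ψ : StrongDual 𝕜 (CompactAlg 𝕜 E)) : CompactAlg 𝕜 E →ₗ[𝕜] 𝕜).comp Y.subtype ∈
      Submodule.span 𝕜 (Set.range fun p =>
        ((L p : StrongDual 𝕜 (CompactAlg 𝕜 E)) : CompactAlg 𝕜 E →ₗ[𝕜] 𝕜).comp Y.subtype) := by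
    refine mem_span_of_iInf_ker_le_ker fun x hx => ?_
    have hxN : (x : CompactAlg 𝕜 E) ∈ N := by
      refine ⟨x.2, (Submodule.mem_iInf _).2 fun p => ?_⟩
      simpa using (Submodule.mem_iInf _).1 hx p
    have := hψ ⟨x, hxN⟩
    simp at this
    simp [this]
  have := Fintype.ofFinite (D ×ˢ Z : Set _)
  obtain ⟨c, hc⟩ := (Submodule.mem_span_range_iff_exists_fun 𝕜).1 hspan
  obtain ⟨x, hxY, hx⟩ := hφ (∑ p, c p • L p)
    (Submodule.sum_mem _ fun p _ => Submodule.smul_mem _ _ (Submodule.subset_span ⟨p.1, rfl⟩))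
  have hcx := LinearMap.congr_fun hc ⟨x, hxY⟩
  simp only [LinearMap.sum_apply, LinearMap.smul_apply, LinearMap.comp_apply, Submodule.subtype_apply,
    ContinuousLinearMap.coe_coe, sub_apply] at hcx
  rw [sum_apply] at hx
  simp only [smul_apply, hcx, sub_sub_cancel] at hx
  exact absurd (ψ.le_of_opNorm_le hψε x) (not_le.2 hx)

end CompactAlg

/-! ### The gliding hump and approximation of functionals on 𝒦(E) -/

namespace CompactAlg

variable {𝕜 E : Type*} [RCLike 𝕜] [NormedAddCommGroup E] [NormedSpace 𝕜 E]

/-- A finite rank operator in the unit ball at which `φ` takes the value `ε`, together with finite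
sets that norm finite-dimensional spaces containing its range and the range of its adjoint. -/
structure HumpStage (φ : StrongDual 𝕜 (CompactAlg 𝕜 E)) (ε : ℝ) where
  /-- the operator -/
  op : CompactAlg 𝕜 E
  /-- a space that contains the range -/
  G : Submodule 𝕜 (StrongDual 𝕜 (StrongDual 𝕜 E))
  /-- a space that contains the range of the adjoint -/
  H : Submodule 𝕜 (StrongDual 𝕜 E)
  /-- a finite set that norms `G` -/
  D : Set (StrongDual 𝕜 E)
  /-- a finite set that norms `H` -/
  Z : Set E
  op_mem : op ∈ finiteRankOps 𝕜 E
  norm_op_le : ‖op‖ ≤ 1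
  apply_op : φ op = (ε : 𝕜)
  fg_G : G.FG
  fg_H : H.FG
  finite_D : D.Finite
  finite_Z : Z.Finite
  isNorming_D : IsNorming D (G : Set (StrongDual 𝕜 (StrongDual 𝕜 E)))
  isNorming_Z : IsNorming Z (H : Set (StrongDual 𝕜 E))
  mem_G : ∀ z, NormedSpace.inclusionInDoubleDual 𝕜 E (op.toCLM z) ∈ G
  mem_H : ∀ f : StrongDual 𝕜 E, f.comp op.toCLM ∈ H

/-- `t` continues `s`: its spaces and norming sets are larger, and its operator vanishes on the
norming sets of `s`. -/
structure HumpStage.Next {φ : StrongDual 𝕜 (CompactAlg 𝕜 E)} {ε : ℝ} (s t : HumpStage φ ε) :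
    Prop where
  G_le : s.G ≤ t.G
  H_le : s.H ≤ t.H
  D_subset : s.D ⊆ t.D
  Z_subset : s.Z ⊆ t.Z
  vanish : ∀ f ∈ s.D, ∀ z ∈ s.Z, f (t.op.toCLM z) = 0

theorem exists_humpStage {φ : StrongDual 𝕜 (CompactAlg 𝕜 E)} {ε : ℝ} (hε : 0 < ε)
    (hφ : ∀ m ∈ coeffSpan 𝕜 E, ∃ x ∈ finiteRankOps 𝕜 E, ε * ‖x‖ < ‖φ x - m x‖)
    {G : Submodule 𝕜 (StrongDual 𝕜 (StrongDual 𝕜 E))} (hG : G.FG)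
    {H : Submodule 𝕜 (StrongDual 𝕜 E)} (hH : H.FG)
    {D : Set (StrongDual 𝕜 E)} (hD : D.Finite) {Z : Set E} (hZ : Z.Finite) :
    ∃ t : HumpStage φ ε, G ≤ t.G ∧ H ≤ t.H ∧ D ⊆ t.D ∧ Z ⊆ t.Z ∧
      ∀ f ∈ D, ∀ z ∈ Z, f (t.op.toCLM z) = 0 := by
  obtain ⟨x, hx, hx1, hφx, hv⟩ := exists_mem_finiteRankOps_of_finite hε hφ hD hZ
  obtain ⟨G', H', hG', hH', hxG, hxH⟩ := exists_fg_submodules hx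
  -- The new sets norm the whole sums: norming the summands separately would not be enough.
  obtain ⟨D', hD', hDn⟩ := exists_finite_isNorming (hG.sup hG')
  obtain ⟨Z', hZ', hZn⟩ := exists_finite_isNorming (hH.sup hH')
  refine ⟨⟨x, G ⊔ G', H ⊔ H', D ∪ D', Z ∪ Z', hx, hx1, hφx, hG.sup hG', hH.sup hH', hD.union hD',
    hZ.union hZ', fun g hg => ?_, fun g hg => ?_, fun z => Submodule.mem_sup_right (hxG z),
    fun f => Submodule.mem_sup_right (hxH f)⟩, le_sup_left, le_sup_left, Set.subset_union_left,
    Set.subset_union_left, hv⟩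
  · obtain ⟨z, hz, h⟩ := hDn g hg
    exact ⟨z, Or.inr hz, h⟩
  · obtain ⟨z, hz, h⟩ := hZn g hg
    exact ⟨z, Or.inr hz, h⟩

/-- A functional that stays away from the span of the functionals `x ↦ f (x z)` takes a fixed
nonzero value along some bounded sequence of finite rank operators that tends to zero in the weak
operator topology. -/
theorem exists_seq_tendsto_weakly_zero (hE : IsReflexiveSpace 𝕜 E)
    {φ : StrongDual 𝕜 (CompactAlg 𝕜 E)} {ε : ℝ} (hε : 0 < ε)
    (hφ : ∀ m ∈ coeffSpan 𝕜 E, ∃ x ∈ finiteRankOps 𝕜 E, ε * ‖x‖ < ‖φ x - m x‖) :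
    ∃ x : ℕ → CompactAlg 𝕜 E, (∀ n, x n ∈ finiteRankOps 𝕜 E) ∧ (∀ n, ‖x n‖ ≤ 1) ∧
      (∀ n, φ (x n) = (ε : 𝕜)) ∧
      ∀ (f : StrongDual 𝕜 E) (z : E), Tendsto (fun n => f ((x n).toCLM z)) atTop (𝓝 0) := by
  have hstep : ∀ s : HumpStage φ ε, ∃ t, s.Next t := fun s => by
    obtain ⟨t, h1, h2, h3, h4, h5⟩ := exists_humpStage hε hφ s.fg_G s.fg_H s.finite_D s.finite_Z
    exact ⟨t, h1, h2, h3, h4, h5⟩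
  choose next hnext using hstep
  obtain ⟨s₀, -⟩ := exists_humpStage hε hφ Submodule.fg_bot Submodule.fg_bot
    Set.finite_empty Set.finite_empty
  let s : ℕ → HumpStage φ ε := fun n => next^[n] s₀
  have hs : ∀ n, (s n).Next (s (n + 1)) := fun n => by
    simp only [s, Function.iterate_succ_apply']
    exact hnext _
  have hGm : Monotone fun n => (s n).G := monotone_nat_of_le_succ fun n => (hs n).G_le
  have hHm : Monotone fun n => (s n).H := monotone_nat_of_le_succ fun n => (hs n).H_le
  have hDm : Monotone fun n => (s n).D := monotone_nat_of_le_succ fun n => (hs n).D_subset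
  have hZm : Monotone fun n => (s n).Z := monotone_nat_of_le_succ fun n => (hs n).Z_subset
  have hGn : IsNorming (⋃ n, (s n).D) (↑(⨆ n, (s n).G) : Set (StrongDual 𝕜 (StrongDual 𝕜 E))) := by
    intro g hg
    obtain ⟨n, hn⟩ := (Submodule.mem_iSup_of_directed _ hGm.directed_le).1 hg
    obtain ⟨z, hz, h⟩ := (s n).isNorming_D g hn
    exact ⟨z, Set.mem_iUnion.2 ⟨n, hz⟩, h⟩
  have hHn : IsNorming (⋃ n, (s n).Z) (↑(⨆ n, (s n).H) : Set (StrongDual 𝕜 E)) := by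
    intro g hg
    obtain ⟨n, hn⟩ := (Submodule.mem_iSup_of_directed _ hHm.directed_le).1 hg
    obtain ⟨z, hz, h⟩ := (s n).isNorming_Z g hn
    exact ⟨z, Set.mem_iUnion.2 ⟨n, hz⟩, h⟩
  refine ⟨fun n => (s n).op, fun n => (s n).op_mem, fun n => (s n).norm_op_le,
    fun n => (s n).apply_op, fun f z => ?_⟩
  have hbound : ∀ n z, ‖(s n).op.toCLM z‖ ≤ ‖z‖ := fun n z =>
    ((s n).op.norm_apply_le z).trans (mul_le_of_le_one_left (norm_nonneg _) (s n).norm_op_le)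
  -- The two variables are released one at a time. With `z` in a norming set, the vectors `op z` act
  -- as functionals on E* that are eventually zero on the sets `D`; afterwards `f` is fixed and f ∘
  -- op is treated in the same way in `z`.
  have h1 : ∀ z ∈ ⋃ n, (s n).Z, ∀ f : StrongDual 𝕜 E,
      Tendsto (fun n => f ((s n).op.toCLM z)) atTop (𝓝 0) := by
    intro z hz f
    obtain ⟨k, hk⟩ := Set.mem_iUnion.1 hz
    refine tendsto_zero_of_isNorming hE.dual
      (fun n => NormedSpace.inclusionInDoubleDual 𝕜 E ((s n).op.toCLM z)) (C := ‖z‖)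
      (fun n => (NormedSpace.double_dual_bound 𝕜 E _).trans (hbound n z))
      (fun n => Submodule.mem_iSup_of_mem n ((s n).mem_G z)) hGn (fun f hf => ?_) f
    obtain ⟨l, hl⟩ := Set.mem_iUnion.1 hf
    refine tendsto_const_nhds.congr' ?_
    -- Strict inequality is needed: the operator of stage `m + 1` vanishes on the sets of stage `m`.
    filter_upwards [eventually_gt_atTop (max k l)] with n hn
    obtain ⟨m, rfl⟩ : ∃ m, n = m + 1 := ⟨n - 1, by omega⟩
    exact ((hs m).vanish f (hDm (by omega) hl) z (hZm (by omega) hk)).symm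
  refine tendsto_zero_of_isNorming hE (fun n => f.comp (s n).op.toCLM) (C := ‖f‖)
    (fun n => ?_) (fun n => Submodule.mem_iSup_of_mem n ((s n).mem_H f)) hHn
    (fun z hz => h1 z hz f) z
  exact (f.opNorm_comp_le _).trans (mul_le_of_le_one_right (norm_nonneg _) (s n).norm_op_le)

/-- On the finite rank operators of a reflexive space, every functional is a norm limit of linear
combinations of the functionals `x ↦ f (x z)`. -/
theorem exists_mem_coeffSpan (hE : IsReflexiveSpace 𝕜 E) (φ : StrongDual 𝕜 (CompactAlg 𝕜 E))
    {ε : ℝ} (hε : 0 < ε) :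
    ∃ m ∈ coeffSpan 𝕜 E, ∀ x ∈ finiteRankOps 𝕜 E, ‖φ x - m x‖ ≤ ε * ‖x‖ := by
  by_contra! hφ
  obtain ⟨x, hxY, hx1, hφx, hlim⟩ := exists_seq_tendsto_weakly_zero hE hε hφ
  let B₁ : Set (WeakDual 𝕜 (StrongDual 𝕜 E)) := WeakDual.toStrongDual ⁻¹' Metric.closedBall 0 1
  let B₂ : Set (WeakDual 𝕜 E) := WeakDual.toStrongDual ⁻¹' Metric.closedBall 0 1
  have : CompactSpace B₁ := isCompact_iff_compactSpace.1 (WeakDual.isCompact_closedBall 0 1)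
  have : CompactSpace B₂ := isCompact_iff_compactSpace.1 (WeakDual.isCompact_closedBall 0 1)
  let v : CompactAlg 𝕜 E → B₁ × B₂ → 𝕜 := fun x k =>
    bidualCoeff (WeakDual.toStrongDual k.1.1) (WeakDual.toStrongDual k.2.1) x
  have hv : ∀ {x}, x ∈ finiteRankOps 𝕜 E → Continuous (v x) := fun hx =>
    (continuous_bidualCoeff hx).comp
      ((continuous_subtype_val.comp continuous_fst).prodMk
        (continuous_subtype_val.comp continuous_snd))
  let F : ℕ → C(B₁ × B₂, ℝ) := fun n => ⟨fun k => ‖v (x n) k‖, (hv (hxY n)).norm⟩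
  have hF1 : ∀ n k, F n k ≤ 1 := by
    intro n k
    have h1 : ‖WeakDual.toStrongDual k.1.1‖ ≤ 1 := (dist_zero_right (WeakDual.toStrongDual k.1.1)).symm.trans_le k.1.2
    have h2 : ‖WeakDual.toStrongDual k.2.1‖ ≤ 1 := (dist_zero_right (WeakDual.toStrongDual k.2.1)).symm.trans_le k.2.2
    exact (norm_bidualCoeff_apply_le _ _ _).trans
      (mul_le_one₀ h1 (by positivity) (mul_le_one₀ h2 (norm_nonneg _) (hx1 n)))
  have hF0 : ∀ k, Tendsto (fun n => F n k) atTop (𝓝 0) := by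
    intro k
    -- Reflexivity turns a point of the bidual ball into a vector, so weak operator convergence
    -- gives convergence at every point of the compact space.
    obtain ⟨z, hz⟩ := hE (WeakDual.toStrongDual k.1.1)
    have := (hlim (WeakDual.toStrongDual k.2.1) z).norm
    rw [norm_zero] at this
    refine this.congr fun n => ?_
    change _ = ‖WeakDual.toStrongDual k.1.1 _‖
    rw [← hz]
    rfl
  let δ : ℝ := ε / (2 * (‖φ‖ + 1))
  have hδ : 0 < δ := by positivity
  obtain ⟨g, hg, hgδ⟩ := exists_mem_convexHull_forall_lt F (fun n k => norm_nonneg (v (x n) k)) hF1 hF0 hδ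
  -- Absolute values are not linear in `x`, but a convex combination of the |v(xₙ)| dominates |v| of
  -- the same combination of the xₙ. Recording domination makes the set convex.
  let S : Set C(B₁ × B₂, ℝ) := {g | ∃ x, φ x = (ε : 𝕜) ∧ ∀ k, ‖v x k‖ ≤ g k}
  have hS : Convex ℝ S := by
    rintro f ⟨x, hx, hxf⟩ g ⟨y, hy, hyg⟩ a b ha hb hab
    refine ⟨(a : 𝕜) • x + (b : 𝕜) • y, ?_, fun k => ?_⟩
    · rw [map_add, map_smul, map_smul, hx, hy, ← add_smul, ← RCLike.ofReal_add, hab,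
        RCLike.ofReal_one, one_smul]
    · have h : v ((a : 𝕜) • x + (b : 𝕜) • y) k = (a : 𝕜) * v x k + (b : 𝕜) * v y k := by
        simp only [v, map_add, map_smul, smul_eq_mul]
      rw [h]
      refine (norm_add_le _ _).trans ?_
      rw [norm_mul, norm_mul, RCLike.norm_ofReal, RCLike.norm_ofReal, abs_of_nonneg ha,
        abs_of_nonneg hb]
      exact add_le_add (mul_le_mul_of_nonneg_left (hxf k) ha)
        (mul_le_mul_of_nonneg_left (hyg k) hb)
  have hFS : Set.range F ⊆ S := Set.range_subset_iff.2 fun n => ⟨x n, hφx n, fun k => le_rfl⟩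
  obtain ⟨y, hy, hyg⟩ := convexHull_min hFS hS hg
  have hyn : ‖y‖ ≤ δ := by
    refine ContinuousLinearMap.opNorm_le_of_unit_norm hδ.le fun z hz => ?_
    obtain ⟨f, hf, hfz⟩ := exists_dual_vector'' 𝕜 (y.toCLM z)
    have := (hyg (⟨StrongDual.toWeakDual (NormedSpace.inclusionInDoubleDual 𝕜 E z), 
      (dist_zero_right (NormedSpace.inclusionInDoubleDual 𝕜 E z)).trans_le
        ((NormedSpace.double_dual_bound 𝕜 E z).trans hz.le)⟩,
      ⟨StrongDual.toWeakDual f, (dist_zero_right f).trans_le hf⟩)).trans (hgδ _).le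
    have h2 : ‖f (y.toCLM z)‖ ≤ δ := this
    rwa [hfz, RCLike.norm_ofReal, abs_norm] at h2
  have h1 : ε ≤ ‖φ‖ * δ := by
    have := φ.le_opNorm_of_le hyn
    rwa [hy, RCLike.norm_ofReal, abs_of_pos hε] at this
  have h2 : ‖φ‖ * δ < ε := by
    have : δ * (2 * (‖φ‖ + 1)) = ε := div_mul_cancel₀ _ (by positivity)
    nlinarith [norm_nonneg φ]
  exact absurd h1 (not_le.2 h2)

end CompactAlg

/-! ### Compact sets and null families -/

/-- A compact set is controlled by a null family: a linear map that is small on the family is small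
on the set. -/
theorem IsCompact.exists_null_family {𝕜 X : Type*} [RCLike 𝕜] [NormedAddCommGroup X]
    [NormedSpace 𝕜 X] {C : Set X} (hC : IsCompact C) :
    ∃ B : Set X, (∀ δ : ℝ, 0 < δ → {b ∈ B | δ ≤ ‖b‖}.Finite) ∧
      ∀ (T : X →L[𝕜] X) (ε : ℝ), (∀ b ∈ B, ‖T b‖ ≤ ε) → ∀ x ∈ C, ‖T x‖ ≤ 2 * ε := by
  have hnet : ∀ k : ℕ, ∃ t ⊆ C, t.Finite ∧ C ⊆ ⋃ y ∈ t, Metric.ball y ((1 / 4 : ℝ) ^ k) := fun k =>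
    hC.finite_cover_balls (by positivity)
  choose N hNC hNfin hN using hnet
  -- A point of `C` is p₀ + ∑ (pₖ₊₁ - pₖ) with pₖ in a 4⁻ᵏ-net. Scaled by 2ᵏ⁺¹, the differences
  -- still have norm at most 4 · 2⁻ᵏ, hence form a null family; the scaling makes the bounds ε /
  -- 2ᵏ⁺¹ summable, with total 2ε including p₀.
  let A : ℕ → Set X := fun k =>
    {a | ∃ p ∈ N (k + 1), ∃ q ∈ N k, a = (2 : 𝕜) ^ (k + 1) • (p - q) ∧ ‖a‖ ≤ 4 * (1 / 2) ^ k}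
  have hA : ∀ k, (A k).Finite := fun k =>
    (((hNfin (k + 1)).prod (hNfin k)).image
      fun w : X × X => (2 : 𝕜) ^ (k + 1) • (w.1 - w.2)).subset (by
        rintro a ⟨p, hp, q, hq, rfl, -⟩
        exact ⟨(p, q), ⟨hp, hq⟩, rfl⟩)
  refine ⟨N 0 ∪ ⋃ k, A k, fun δ hδ => ?_, fun T ε hT x hx => ?_⟩
  · obtain ⟨K, hK⟩ := exists_pow_lt_of_lt_one (show 0 < δ / 4 by positivity)
      (show (1 / 2 : ℝ) < 1 by norm_num)
    refine ((hNfin 0).union ((Set.finite_lt_nat K).biUnion fun k _ => hA k)).subset ?_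
    rintro b ⟨hb | hb, hδb⟩
    · exact Or.inl hb
    · obtain ⟨k, hk⟩ := Set.mem_iUnion.1 hb
      refine Or.inr (Set.mem_biUnion (x := k) ?_ hk)
      by_contra hkK
      obtain ⟨_, _, _, _, _, hle⟩ := hk
      have h1 : (1 / 2 : ℝ) ^ k ≤ (1 / 2) ^ K :=
        pow_le_pow_of_le_one (by norm_num) (by norm_num) (not_lt.1 hkK)
      linarith
  · have hx' : ∀ k, ∃ p ∈ N k, ‖x - p‖ < (1 / 4 : ℝ) ^ k := fun k => by
      obtain ⟨p, hp, h⟩ := Set.mem_iUnion₂.1 (hN k hx)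
      exact ⟨p, hp, by rwa [← dist_eq_norm]⟩
    choose p hpN hp using hx'
    have hTp : ∀ k, ‖T (p k)‖ ≤ ε * (2 - (1 / 2) ^ k) := by
      intro k
      induction k with
      | zero => simpa [show (2 : ℝ) - 1 = 1 by norm_num] using hT _ (Or.inl (hpN 0))
      | succ k ih =>
        have hpos : (0 : ℝ) < 2 ^ (k + 1) := by positivity
        have hn2 : ‖(2 : 𝕜) ^ (k + 1)‖ = 2 ^ (k + 1) := by simp
        have hd : ‖p (k + 1) - p k‖ ≤ 2 * (1 / 4) ^ k := by
          have h1 : ‖p (k + 1) - p k‖ ≤ ‖x - p k‖ + ‖x - p (k + 1)‖ := by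
            simpa using norm_sub_le (x - p k) (x - p (k + 1))
          have h2 : (1 / 4 : ℝ) ^ (k + 1) ≤ (1 / 4) ^ k :=
            pow_le_pow_of_le_one (by norm_num) (by norm_num) k.le_succ
          linarith [hp k, hp (k + 1)]
        have hmem : (2 : 𝕜) ^ (k + 1) • (p (k + 1) - p k) ∈ A k := by
          refine ⟨_, hpN _, _, hpN _, rfl, ?_⟩
          rw [norm_smul, hn2]
          calc (2 : ℝ) ^ (k + 1) * ‖p (k + 1) - p k‖ ≤ 2 ^ (k + 1) * (2 * (1 / 4) ^ k) :=
                mul_le_mul_of_nonneg_left hd hpos.le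
            _ = 4 * (2 * (1 / 4)) ^ k := by rw [mul_pow]; ring
            _ = 4 * (1 / 2) ^ k := by norm_num
        have h3 := hT _ (Or.inr (Set.mem_iUnion.2 ⟨k, hmem⟩))
        rw [map_smul, norm_smul, hn2, mul_comm, ← le_div_iff₀ hpos] at h3
        have h4 : ‖T (p (k + 1))‖ ≤ ‖T (p (k + 1) - p k)‖ + ‖T (p k)‖ := by
          simpa using norm_add_le (T (p (k + 1) - p k)) (T (p k))
        have h5 : ε / 2 ^ (k + 1) = ε * (1 / 2) ^ (k + 1) := by
          rw [div_pow, one_pow, mul_one_div]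
        rw [h5] at h3
        have h6 : (1 / 2 : ℝ) ^ k = 2 * (1 / 2) ^ (k + 1) := by rw [pow_succ]; ring
        rw [h6] at ih
        linarith
    have hε : 0 ≤ ε := (norm_nonneg _).trans (hT _ (Or.inl (hpN 0)))
    have hlim : Tendsto p atTop (𝓝 x) := by
      rw [tendsto_iff_norm_sub_tendsto_zero]
      refine squeeze_zero (fun _ => norm_nonneg _) (fun k => ?_)
        (tendsto_pow_atTop_nhds_zero_of_lt_one (show (0 : ℝ) ≤ 1 / 4 by norm_num) (by norm_num))
      rw [norm_sub_rev]
      exact (hp k).le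
    refine le_of_tendsto' ((T.continuous.tendsto x).comp hlim).norm fun k => (hTp k).trans ?_
    have : (0 : ℝ) ≤ (1 / 2) ^ k := by positivity
    nlinarith

/-! ### Finite rank operators as sums of rank one operators -/

namespace CompactAlg

variable {𝕜 E : Type*} [RCLike 𝕜] [NormedAddCommGroup E] [NormedSpace 𝕜 E]

theorem sum_rankOne_mem_finiteRankOps {ι : Type*} (s : Finset ι) (f : ι → StrongDual 𝕜 E)
    (y : ι → E) : ∑ i ∈ s, rankOne (f i) (y i) ∈ finiteRankOps 𝕜 E :=
  Submodule.sum_mem _ fun i _ => Submodule.subset_span ⟨(f i, y i), rfl⟩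

/-- The adjoint of an element of `𝒦(E)`. -/
noncomputable def adj (𝕜 E : Type*) [RCLike 𝕜] [NormedAddCommGroup E] [NormedSpace 𝕜 E] :
    CompactAlg 𝕜 E →ₗ[𝕜] StrongDual 𝕜 E →L[𝕜] StrongDual 𝕜 E :=
  ((ContinuousLinearMap.compL 𝕜 E E 𝕜).flip.comp (toCLML 𝕜 E)).toLinearMap

end CompactAlg

/-- A bounded operator with finite-dimensional range is a finite sum `z ↦ ∑ i, f i z • y i`. -/
theorem exists_eq_sum_of_finiteDimensional_range {𝕜 X Y : Type*} [RCLike 𝕜] [NormedAddCommGroup X]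
    [NormedSpace 𝕜 X] [NormedAddCommGroup Y] [NormedSpace 𝕜 Y] (T : X →L[𝕜] Y)
    (hT : FiniteDimensional 𝕜 (LinearMap.range (T : X →ₗ[𝕜] Y))) :
    ∃ (n : ℕ) (f : Fin n → StrongDual 𝕜 X) (y : Fin n → Y), ∀ z, T z = ∑ i, f i z • y i := by
  let R := LinearMap.range (T : X →ₗ[𝕜] Y)
  let b := Module.finBasis 𝕜 R
  let T' : X →L[𝕜] R := T.codRestrict R fun x => ⟨x, rfl⟩
  refine ⟨_, fun i => (LinearMap.toContinuousLinearMap (b.coord i)).comp T', fun i => b i,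
    fun z => ?_⟩
  have := congrArg Subtype.val (b.sum_repr (T' z))
  rw [Submodule.coe_sum] at this
  exact this.symm

namespace CompactAlg

variable {𝕜 E : Type*} [RCLike 𝕜] [NormedAddCommGroup E] [NormedSpace 𝕜 E]

theorem exists_toCLM_eq (S : E →L[𝕜] E)
    (hS : FiniteDimensional 𝕜 (LinearMap.range (S : E →ₗ[𝕜] E))) :
    ∃ x ∈ finiteRankOps 𝕜 E, x.toCLM = S := by
  obtain ⟨n, f, y, h⟩ := exists_eq_sum_of_finiteDimensional_range S hS
  refine ⟨∑ i, rankOne (f i) (y i), sum_rankOne_mem_finiteRankOps _ _ _, ?_⟩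
  ext z
  rw [h, ← toCLML_apply, map_sum, sum_apply]
  rfl

theorem exists_finiteRankOps_of_isCompact (hap : HasApproximationProperty 𝕜 E)
    {C : Set E} (hC : IsCompact C) {ε : ℝ} (hε : 0 < ε) :
    ∃ x ∈ finiteRankOps 𝕜 E, ∀ z ∈ C, ‖x.toCLM z - z‖ ≤ ε := by
  obtain ⟨S, hS, h⟩ := hap C hC ε hε
  obtain ⟨x, hx, rfl⟩ := exists_toCLM_eq S hS
  exact ⟨x, hx, h⟩

end CompactAlg

/-! ### Duality for null families and passage to adjoints -/

section NullFamilies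

variable {𝕜 : Type*} [RCLike 𝕜] {X : Type*} [NormedAddCommGroup X] [NormedSpace 𝕜 X]

theorem IsReflexiveSpace.exists_apply_eq_norm (hX : IsReflexiveSpace 𝕜 X) (g : StrongDual 𝕜 X) :
    ∃ x : X, ‖x‖ ≤ 1 ∧ g x = (‖g‖ : 𝕜) := by
  obtain ⟨Φ, hΦ, hΦg⟩ := exists_dual_vector'' 𝕜 g
  obtain ⟨x, rfl⟩ := hX Φ
  exact ⟨x, ((NormedSpace.inclusionInDoubleDualLi 𝕜 (E := X)).norm_map x).symm.trans_le hΦ, hΦg⟩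

theorem exists_norm_le_of_tendsto_cofinite {ι : Type*} {b : ι → X}
    (hb : Tendsto b cofinite (𝓝 0)) : ∃ C, ∀ i, ‖b i‖ ≤ C := by
  have hfin : {i | ¬ ‖b i‖ < 1}.Finite := hb.norm.eventually_lt_const (u := 1) (by simp)
  obtain ⟨C, hC⟩ := (hfin.image fun i => ‖b i‖).bddAbove
  refine ⟨max C 1, fun i => ?_⟩
  by_cases h : ‖b i‖ < 1
  · exact h.le.trans (le_max_right _ _)
  · exact (hC ⟨i, h, rfl⟩).trans (le_max_left _ _)

theorem norm_single_apply_le {ι : Type*} [DecidableEq ι] (i j : ι) (f : X) :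
    ‖(Pi.single i f : ι → X) j‖ ≤ ‖f‖ := by
  by_cases h : j = i
  · subst h; simp
  · simp [Pi.single_eq_of_ne h]

open scoped Classical in
/-- The family that is `f` at `i` and zero elsewhere. -/
noncomputable def BoundedContinuousFunction.singleFamily {ι : Type*} [TopologicalSpace ι]
    [DiscreteTopology ι] (i : ι) (f : X) : BoundedContinuousFunction ι X :=
  BoundedContinuousFunction.ofNormedAddCommGroupDiscrete (Pi.single i f : ι → X) ‖f‖ fun j =>
    norm_single_apply_le i j f

open scoped Classical in
theorem BoundedContinuousFunction.sum_singleFamily_apply {ι : Type*} [TopologicalSpace ι]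
    [DiscreteTopology ι] (s : Finset ι) (h : ι → X) (j : ι) :
    (∑ i ∈ s, singleFamily i (h i)) j = if j ∈ s then h j else 0 := by
  rw [BoundedContinuousFunction.sum_apply]
  change ∑ i ∈ s, (Pi.single i (h i) : ι → X) j = _
  simp [Pi.single_apply]

open BoundedContinuousFunction in
/-- On null families, a functional is given by an absolutely summable family of functionals. -/
theorem exists_summable_representation (hX : IsReflexiveSpace 𝕜 X) {ι : Type*} [TopologicalSpace ι]
    [DiscreteTopology ι] (Ψ : StrongDual 𝕜 (BoundedContinuousFunction ι X)) :
    ∃ z : ι → StrongDual 𝕜 X, (∀ s : Finset ι, ∑ i ∈ s, ‖z i‖ ≤ ‖Ψ‖) ∧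
      ∀ (h : BoundedContinuousFunction ι X) (δ : ℝ), 0 ≤ δ → ∀ s : Finset ι,
        (∀ i ∉ s, ‖h i‖ ≤ δ) → ‖Ψ h - ∑ i ∈ s, z i (h i)‖ ≤ ‖Ψ‖ * δ := by
  classical
  have hn : ∀ (i : ι) (f : X), ‖singleFamily i f‖ ≤ ‖f‖ := fun i f =>
    (BoundedContinuousFunction.norm_le (norm_nonneg f)).2 fun j => norm_single_apply_le i j f
  let z : ι → StrongDual 𝕜 X := fun i => LinearMap.mkContinuous
    { toFun := fun f => Ψ (singleFamily i f)
      map_add' := fun f g => by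
        rw [← map_add]
        congr 1
        ext1 j
        change (Pi.single i (f + g) : ι → X) j = (Pi.single i f : ι → X) j + (Pi.single i g : ι → X) j
        rw [Pi.single_add, Pi.add_apply]
      map_smul' := fun c f => by
        rw [RingHom.id_apply, ← map_smul]
        congr 1
        ext1 j
        change (Pi.single i (c • f) : ι → X) j = c • (Pi.single i f : ι → X) j
        rw [Pi.single_smul, Pi.smul_apply] } ‖Ψ‖
    fun f => Ψ.le_of_opNorm_le_of_le le_rfl (hn i f)
  have hz : ∀ i f, z i f = Ψ (singleFamily i f) := fun i f => rfl
  refine ⟨z, fun s => ?_, fun h δ hδ s hs => ?_⟩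
  -- Each `z i` attains its norm in the unit ball. Testing `Ψ` on these vectors, supported on `s`,
  -- gives the sum of the norms from a family of sup norm at most 1.
  · choose f hf hfz using fun i => hX.exists_apply_eq_norm (z i)
    have h1 : Ψ (∑ i ∈ s, singleFamily i (f i)) = ((∑ i ∈ s, ‖z i‖ : ℝ) : 𝕜) := by
      rw [map_sum, RCLike.ofReal_sum]
      exact Finset.sum_congr rfl fun i _ => by rw [← hz, hfz]
    have h2 : ‖∑ i ∈ s, singleFamily i (f i)‖ ≤ 1 :=
      (BoundedContinuousFunction.norm_le zero_le_one).2 fun j => by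
        rw [sum_singleFamily_apply]
        split_ifs
        · exact hf j
        · simp
    have h3 := Ψ.le_opNorm_of_le h2
    rwa [h1, mul_one, RCLike.norm_ofReal,
      abs_of_nonneg (Finset.sum_nonneg fun i _ => norm_nonneg _)] at h3
  · have h1 : ‖h - ∑ i ∈ s, singleFamily i (h i)‖ ≤ δ :=
      (BoundedContinuousFunction.norm_le hδ).2 fun j => by
        rw [BoundedContinuousFunction.sub_apply, sum_singleFamily_apply]
        split_ifs with hj
        · simpa using hδ
        · simpa using hs j hj
    have h2 := Ψ.le_opNorm_of_le h1
    rw [map_sub, map_sum] at h2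
    exact h2

/-- The family `A (b i)` as a function of the operator `A`, for a bounded family `b`. -/
noncomputable def applyFamily {ι : Type*} [TopologicalSpace ι] [DiscreteTopology ι]
    (b : BoundedContinuousFunction ι X) :
    (X →L[𝕜] X) →ₗ[𝕜] BoundedContinuousFunction ι X where
  toFun A := BoundedContinuousFunction.ofNormedAddCommGroupDiscrete (fun i => A (b i))
    (‖A‖ * ‖b‖) fun i => A.le_opNorm_of_le (b.norm_coe_le_norm i)
  map_add' A B := by ext i; rfl
  map_smul' c A := by ext i; rfl

/-- A functional that kills the families `A (b i)` kills the null family `b`, if the adjoints of the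
operators `A` approximate the identity on null families. -/
theorem apply_eq_zero_of_applyFamily (hX : IsReflexiveSpace 𝕜 X) {ι : Type*} [TopologicalSpace ι]
    [DiscreteTopology ι] (𝒜 : Submodule 𝕜 (X →L[𝕜] X))
    (h𝒜 : ∀ ζ : ι → StrongDual 𝕜 X, Tendsto ζ cofinite (𝓝 0) → ∀ δ : ℝ, 0 < δ →
      ∃ A ∈ 𝒜, ∀ i, ‖(ζ i).comp A - ζ i‖ ≤ δ)
    (b : BoundedContinuousFunction ι X) (hb : Tendsto b cofinite (𝓝 0))
    (Ψ : StrongDual 𝕜 (BoundedContinuousFunction ι X))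
    (hΨ : ∀ A ∈ 𝒜, Ψ (applyFamily b A) = 0) : Ψ b = 0 := by
  by_contra hΨb
  obtain ⟨ζ, hζ, hΨζ⟩ := exists_summable_representation hX Ψ
  -- Rescaling moves the decay of `b` to the functionals: ‖ζ' i‖ ≤ ‖b i‖, and ‖ζᵢ(A bᵢ - bᵢ)‖ ≤ ‖ζᵢ
  -- ∘ A - ζᵢ‖ ‖bᵢ‖ = ‖ζᵢ‖ ‖ζ'ᵢ ∘ A - ζ'ᵢ‖ ≤ δ‖ζᵢ‖, which is summable.
  let ζ' : ι → StrongDual 𝕜 X := fun i => ((‖b i‖ / ‖ζ i‖ : ℝ) : 𝕜) • ζ i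
  have hζ' : Tendsto ζ' cofinite (𝓝 0) := by
    refine squeeze_zero_norm (fun i => ?_) (by simpa using hb.norm)
    rw [norm_smul, RCLike.norm_ofReal, abs_of_nonneg (by positivity)]
    by_cases h : ‖ζ i‖ = 0
    · simp [h]
    · rw [div_mul_cancel₀ _ h]
  let δ : ℝ := ‖Ψ b‖ / (4 * (‖Ψ‖ + 1))
  have hδ : 0 < δ := by
    have := norm_pos_iff.2 hΨb
    positivity
  obtain ⟨A, hA, hAζ⟩ := h𝒜 ζ' hζ' δ hδ
  -- As `Ψ` kills the family `A (b i)`, it has the same modulus at `h` as at `b`. The finitely many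
  -- large entries of `h` and the tail each contribute at most ‖Ψ‖δ, too little by the choice of
  -- `δ`.
  let h := applyFamily b A - b
  have hnull : Tendsto h cofinite (𝓝 0) := by
    have h1 : Tendsto (fun i => A (b i)) cofinite (𝓝 (A 0)) := (A.continuous.tendsto 0).comp hb
    rw [map_zero] at h1
    have h2 := h1.sub hb
    rw [sub_zero] at h2
    exact h2
  have hfin : {i | ¬ ‖h i‖ < δ}.Finite :=
    hnull.norm.eventually_lt_const (u := δ) (by rwa [norm_zero])
  have h1 := hΨζ h δ hδ.le hfin.toFinset fun i hi => by
    by_contra hlt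
    exact hi (hfin.mem_toFinset.2 fun h' => hlt h'.le)
  have h2 : ‖∑ i ∈ hfin.toFinset, ζ i (h i)‖ ≤ ‖Ψ‖ * δ := by
    refine (norm_sum_le _ _).trans ((Finset.sum_le_sum fun i _ => ?_).trans
      ((Finset.sum_mul hfin.toFinset (fun i => ‖ζ i‖) δ).symm.trans_le
        (mul_le_mul_of_nonneg_right (hζ _) hδ.le)))
    by_cases hζi : ζ i = 0
    · simp [hζi]
    have hζn : 0 < ‖ζ i‖ := norm_pos_iff.2 hζi
    have h3 := hAζ i
    have h4 : (ζ' i).comp A - ζ' i = ((‖b i‖ / ‖ζ i‖ : ℝ) : 𝕜) • ((ζ i).comp A - ζ i) := by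
      simp only [ζ', smul_sub, ContinuousLinearMap.smul_comp]
    rw [h4, norm_smul, RCLike.norm_ofReal, abs_of_nonneg (by positivity), div_mul_eq_mul_div,
      div_le_iff₀ hζn, mul_comm δ, mul_comm ‖b i‖] at h3
    have h5 : ζ i (h i) = ((ζ i).comp A - ζ i) (b i) :=
      map_sub (ζ i) (A (b i)) (b i)
    rw [h5]
    exact (ContinuousLinearMap.le_opNorm _ _).trans h3
  have h4 : ‖Ψ b‖ ≤ ‖Ψ‖ * δ + ‖Ψ‖ * δ := by
    have h5 : ‖Ψ b‖ = ‖Ψ h‖ := by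
      rw [map_sub, hΨ A hA, zero_sub, norm_neg]
    rw [h5]
    exact (norm_le_norm_sub_add _ _).trans (add_le_add h1 h2)
  have h5 : δ * (4 * (‖Ψ‖ + 1)) = ‖Ψ b‖ := div_mul_cancel₀ _ (by positivity)
  nlinarith [norm_nonneg Ψ]

/-- If the adjoints of the operators in a subspace approximate the identity on null families, then
so do the operators themselves. -/
theorem exists_apply_sub_le_of_null (hX : IsReflexiveSpace 𝕜 X) {ι : Type*}
    (𝒜 : Submodule 𝕜 (X →L[𝕜] X))
    (h𝒜 : ∀ ζ : ι → StrongDual 𝕜 X, Tendsto ζ cofinite (𝓝 0) → ∀ δ : ℝ, 0 < δ →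
      ∃ A ∈ 𝒜, ∀ i, ‖(ζ i).comp A - ζ i‖ ≤ δ)
    (b : ι → X) (hb : Tendsto b cofinite (𝓝 0)) {ε : ℝ} (hε : 0 < ε) :
    ∃ A ∈ 𝒜, ∀ i, ‖A (b i) - b i‖ ≤ ε := by
  -- With the discrete topology, bounded continuous functions are simply bounded families.
  let _ : TopologicalSpace ι := ⊥
  have : DiscreteTopology ι := ⟨rfl⟩
  obtain ⟨C, hC⟩ := exists_norm_le_of_tendsto_cofinite hb
  let β := BoundedContinuousFunction.ofNormedAddCommGroupDiscrete b C hC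
  have hcl : β ∈ closure (𝒜.map (applyFamily β) : Set (BoundedContinuousFunction ι X)) := by
    by_contra hcl
    obtain ⟨Ψ, hΨ, hΨβ⟩ := exists_dual_ne_zero_of_notMem_closure _ hcl
    exact hΨβ (apply_eq_zero_of_applyFamily hX 𝒜 h𝒜 β hb Ψ fun A hA => hΨ _ ⟨A, hA, rfl⟩)
  obtain ⟨_, ⟨A, hA, rfl⟩, hd⟩ := Metric.mem_closure_iff.1 hcl ε hε
  refine ⟨A, hA, fun i => ?_⟩
  rw [dist_comm] at hd
  exact (dist_eq_norm _ _).symm.trans_le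
    ((BoundedContinuousFunction.dist_coe_le_dist (f := applyFamily β A) (g := β) i).trans hd.le)

/-- If the adjoints of the operators in a subspace approximate the identity uniformly on compact
sets, then so do the operators themselves. -/
theorem exists_apply_sub_le_of_isCompact (hX : IsReflexiveSpace 𝕜 X) (𝒜 : Submodule 𝕜 (X →L[𝕜] X))
    (h𝒜 : ∀ K : Set (StrongDual 𝕜 X), IsCompact K → ∀ δ : ℝ, 0 < δ →
      ∃ A ∈ 𝒜, ∀ ζ ∈ K, ‖ζ.comp A - ζ‖ ≤ δ)
    {C : Set X} (hC : IsCompact C) {ε : ℝ} (hε : 0 < ε) :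
    ∃ A ∈ 𝒜, ∀ x ∈ C, ‖A x - x‖ ≤ ε := by
  obtain ⟨B, hB, hBC⟩ := hC.exists_null_family (𝕜 := 𝕜)
  have hnull : Tendsto (fun b : B => (b : X)) cofinite (𝓝 0) := by
    rw [Metric.tendsto_nhds]
    intro δ hδ
    refine ((hB δ hδ).preimage Subtype.val_injective.injOn).subset fun b hb => ⟨b.2, ?_⟩
    simpa using hb
  obtain ⟨A, hA, h⟩ := exists_apply_sub_le_of_null hX 𝒜 (fun ζ hζ δ hδ => by
    obtain ⟨A, hA, h⟩ := h𝒜 _ hζ.isCompact_insert_range_of_cofinite δ hδ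
    exact ⟨A, hA, fun i => h _ (Or.inr ⟨i, rfl⟩)⟩) _ hnull (half_pos hε)
  refine ⟨A, hA, fun x hx => ?_⟩
  have := hBC (A - ContinuousLinearMap.id 𝕜 X) (ε / 2) (fun b hb => h ⟨b, hb⟩) x hx
  rwa [mul_div_cancel₀ _ two_ne_zero] at this

end NullFamilies

/-! ### Adjoints of finite rank operators -/

namespace CompactAlg

variable {𝕜 E : Type*} [RCLike 𝕜] [NormedAddCommGroup E] [NormedSpace 𝕜 E]

/-- Adjoints of finite rank operators approximate the identity uniformly on compact sets of the
dual of a reflexive space with the approximation property. -/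
theorem exists_adj_sub_le (hE : IsReflexiveSpace 𝕜 E) (hap : HasApproximationProperty 𝕜 E)
    {C : Set (StrongDual 𝕜 E)} (hC : IsCompact C) {ε : ℝ} (hε : 0 < ε) :
    ∃ x ∈ finiteRankOps 𝕜 E, ∀ f ∈ C, ‖f.comp x.toCLM - f‖ ≤ ε := by
  -- The criterion is applied to E* and the adjoints of finite rank operators. Their own adjoints
  -- act on E** = E as the original operators, so its hypothesis is the approximation property of E.
  obtain ⟨_, ⟨x, hx, rfl⟩, h⟩ := exists_apply_sub_le_of_isCompact hE.dual
    ((finiteRankOps 𝕜 E).map (adj 𝕜 E)) (fun K hK δ hδ => by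
      let J := NormedSpace.inclusionInDoubleDualLi 𝕜 (E := E)
      have hK' : IsCompact (J ⁻¹' K) := by
        rw [J.isometry.isEmbedding.isCompact_iff, Set.image_preimage_eq (f := J) K hE]
        exact hK
      obtain ⟨x, hx, h⟩ := exists_finiteRankOps_of_isCompact hap hK' hδ
      refine ⟨adj 𝕜 E x, ⟨x, hx, rfl⟩, fun ζ hζ => ?_⟩
      obtain ⟨e, rfl⟩ := hE ζ
      have := h e hζ
      rw [← J.norm_map, LinearIsometry.map_sub] at this
      exact this) hC hε
  exact ⟨x, hx, h⟩

end CompactAlg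

/-! ### Compactness and density of elementary operators -/

namespace CompactAlg

variable {𝕜 E : Type*} [RCLike 𝕜] [NormedAddCommGroup E] [NormedSpace 𝕜 E]

theorem toCLM_sub (S T : CompactAlg 𝕜 E) : (S - T).toCLM = S.toCLM - T.toCLM := rfl

theorem norm_le_of_unit_norm {x : CompactAlg 𝕜 E} {C : ℝ} (hC : 0 ≤ C)
    (h : ∀ z, ‖z‖ = 1 → ‖x.toCLM z‖ ≤ C) : ‖x‖ ≤ C :=
  x.toCLM.opNorm_le_of_unit_norm hC h

instance [CompleteSpace E] : CompleteSpace (CompactAlg 𝕜 E) :=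
  (isClosed_setOfPred_isCompactOperator (σ₁₂ := RingHom.id 𝕜) (M₁ := E)
    (M₂ := E)).completeSpace_coe

theorem rankOne_mul (f : StrongDual 𝕜 E) (y : E) (x : CompactAlg 𝕜 E) :
    rankOne f y * x = rankOne (f.comp x.toCLM) y := rfl

theorem rankOne_sub (f g : StrongDual 𝕜 E) (y : E) :
    rankOne (f - g) y = rankOne f y - rankOne g y := by
  apply toCLM_injective
  ext z
  exact sub_smul _ _ _

theorem norm_rankOne_le (f : StrongDual 𝕜 E) (y : E) : ‖rankOne f y‖ ≤ ‖f‖ * ‖y‖ :=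
  (ContinuousLinearMap.norm_smulRight_apply f y).le

theorem mul_mem_finiteRankOps {S : CompactAlg 𝕜 E} (hS : S ∈ finiteRankOps 𝕜 E)
    (x : CompactAlg 𝕜 E) : S * x ∈ finiteRankOps 𝕜 E := by
  induction hS using Submodule.span_induction with
  | mem S hS =>
    obtain ⟨⟨f, y⟩, rfl⟩ := hS
    exact Submodule.subset_span ⟨(f.comp x.toCLM, y), rfl⟩
  | zero => rw [zero_mul]; exact Submodule.zero_mem _
  | add S T _ _ hS hT => rw [add_mul]; exact Submodule.add_mem _ hS hT
  | smul c S _ hS => rw [smul_mul_assoc]; exact Submodule.smul_mem _ c hS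

/-- A compact set of compact operators is collectively compact. -/
theorem isCompact_closure_biUnion_image [CompleteSpace E] {C : Set (CompactAlg 𝕜 E)}
    (hC : IsCompact C) :
    IsCompact (closure (⋃ x ∈ C, x.toCLM '' Metric.closedBall 0 1)) := by
  refine (TotallyBounded.closure ?_).isCompact_of_isClosed isClosed_closure
  rw [Metric.totallyBounded_iff]
  intro η hη
  obtain ⟨t, -, htfin, ht⟩ := hC.finite_cover_balls (half_pos hη)
  have hU : TotallyBounded (⋃ x ∈ t, x.toCLM '' Metric.closedBall 0 1) :=
    (totallyBounded_biUnion htfin).2 fun x _ =>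
      (x.isCompactOperator.isCompact_closure_image_closedBall (f := (x.toCLM : E →ₗ[𝕜] E))
        1).totallyBounded.subset subset_closure
  obtain ⟨t', ht'fin, ht'⟩ := Metric.totallyBounded_iff.1 hU (η / 2) (half_pos hη)
  refine ⟨t', ht'fin, ?_⟩
  intro w hw
  obtain ⟨x, hx, z, hz, rfl⟩ := Set.mem_iUnion₂.1 hw
  obtain ⟨x', hx't, hxx'⟩ := Set.mem_iUnion₂.1 (ht hx)
  obtain ⟨y, hy, hxy⟩ := Set.mem_iUnion₂.1 (ht' (Set.mem_biUnion hx't ⟨z, hz, rfl⟩))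
  refine Set.mem_iUnion₂.2 ⟨y, hy, ?_⟩
  rw [Metric.mem_ball] at hxy hxx' ⊢
  have h1 : dist (x.toCLM z) (x'.toCLM z) ≤ dist x x' := by
    rw [dist_eq_norm, dist_eq_norm]
    have h2 := (x - x').norm_apply_le z
    have h3 : ‖z‖ ≤ 1 := mem_closedBall_zero_iff.1 hz
    rw [toCLM_sub, sub_apply] at h2
    exact h2.trans (mul_le_of_le_one_right (norm_nonneg _) h3)
  linarith [dist_triangle (x.toCLM z) (x'.toCLM z) y]

/-- ‖Sx - x‖ is a supremum of ‖S(xz) - xz‖ over unit vectors z, and all the xz lie in one compact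
set. -/
theorem exists_mul_sub_le [CompleteSpace E] (hap : HasApproximationProperty 𝕜 E)
    {C : Set (CompactAlg 𝕜 E)} (hC : IsCompact C) {ε : ℝ} (hε : 0 < ε) :
    ∃ S ∈ finiteRankOps 𝕜 E, ∀ x ∈ C, ‖S * x - x‖ ≤ ε := by
  obtain ⟨S, hS, h⟩ := exists_finiteRankOps_of_isCompact hap
    (isCompact_closure_biUnion_image hC) hε
  refine ⟨S, hS, fun x hx => norm_le_of_unit_norm hε.le fun z hz => ?_⟩
  exact h _ (subset_closure (Set.mem_biUnion hx ⟨z, by simp [hz], rfl⟩))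

theorem dense_finiteRankOps [CompleteSpace E] (hap : HasApproximationProperty 𝕜 E) :
    Dense (finiteRankOps 𝕜 E : Set (CompactAlg 𝕜 E)) := by
  intro a
  rw [Metric.mem_closure_iff]
  intro ε hε
  obtain ⟨S, hS, h⟩ := exists_mul_sub_le hap (isCompact_singleton (x := a)) (half_pos hε)
  refine ⟨S * a, mul_mem_finiteRankOps hS a, ?_⟩
  rw [dist_comm, dist_eq_norm]
  exact (h a rfl).trans_lt (half_lt_self hε)

/-- For S = f ⊗ y one has SxR - Sx = ((f ∘ x) ∘ R - f ∘ x) ⊗ y, and f ∘ x runs through a compact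
subset of E*. Both `K` and `c` depend on `S` and `C` only, so `R` may be chosen after them. -/
theorem exists_isCompact_norm_mul_mul_sub_le {S : CompactAlg 𝕜 E} (hS : S ∈ finiteRankOps 𝕜 E)
    {C : Set (CompactAlg 𝕜 E)} (hC : IsCompact C) :
    ∃ (K : Set (StrongDual 𝕜 E)) (c : ℝ), IsCompact K ∧ 0 ≤ c ∧ ∀ (R : CompactAlg 𝕜 E) (η : ℝ),
      (∀ f ∈ K, ‖f.comp R.toCLM - f‖ ≤ η) → ∀ x ∈ C, ‖S * x * R - S * x‖ ≤ c * η := by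
  induction hS using Submodule.span_induction with
  | mem S hS =>
    obtain ⟨⟨f, y⟩, rfl⟩ := hS
    refine ⟨(fun x : CompactAlg 𝕜 E => f.comp x.toCLM) '' C, ‖y‖, hC.image ?_, norm_nonneg _,
      fun R η h x hx => ?_⟩
    · exact ((ContinuousLinearMap.compL 𝕜 E E 𝕜 f).comp (toCLML 𝕜 E)).continuous
    · rw [rankOne_mul, rankOne_mul, ← rankOne_sub, mul_comm]
      exact (norm_rankOne_le _ _).trans
        (mul_le_mul_of_nonneg_right (h _ ⟨x, hx, rfl⟩) (norm_nonneg _))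
  | zero => exact ⟨∅, 0, isCompact_empty, le_rfl, fun R η _ x _ => by simp⟩
  | add S T _ _ hS hT =>
    obtain ⟨K, c, hK, hc, h⟩ := hS
    obtain ⟨K', c', hK', hc', h'⟩ := hT
    refine ⟨K ∪ K', c + c', hK.union hK', add_nonneg hc hc', fun R η hR x hx => ?_⟩
    have h1 := h R η (fun f hf => hR f (Or.inl hf)) x hx
    have h2 := h' R η (fun f hf => hR f (Or.inr hf)) x hx
    rw [add_mul, add_mul, add_sub_add_comm, add_mul c]
    exact (norm_add_le _ _).trans (add_le_add h1 h2)
  | smul a S _ hS =>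
    obtain ⟨K, c, hK, hc, h⟩ := hS
    refine ⟨K, ‖a‖ * c, hK, by positivity, fun R η hR x hx => ?_⟩
    rw [smul_mul_assoc, smul_mul_assoc, ← smul_sub, norm_smul, mul_assoc ‖a‖]
    exact mul_le_mul_of_nonneg_left (h R η hR x hx) (norm_nonneg a)

theorem exists_mul_mul_sub_le [CompleteSpace E] (hE : IsReflexiveSpace 𝕜 E)
    (hap : HasApproximationProperty 𝕜 E) {C : Set (CompactAlg 𝕜 E)} (hC : IsCompact C) {ε : ℝ}
    (hε : 0 < ε) :
    ∃ S ∈ finiteRankOps 𝕜 E, ∃ R ∈ finiteRankOps 𝕜 E, ∀ x ∈ C, ‖S * x * R - x‖ ≤ ε := by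
  obtain ⟨S, hS, h⟩ := exists_mul_sub_le hap hC (half_pos hε)
  obtain ⟨K, c, hK, hc, hKc⟩ := exists_isCompact_norm_mul_mul_sub_le hS hC
  -- Dividing by c + 1 rather than c covers c = 0.
  obtain ⟨R, hR, hRK⟩ := exists_adj_sub_le hE hap hK (show 0 < ε / (2 * (c + 1)) by positivity)
  refine ⟨S, hS, R, hR, fun x hx => ?_⟩
  have h1 := hKc R _ hRK x hx
  have h2 : c * (ε / (2 * (c + 1))) ≤ ε / 2 := by
    rw [← mul_div_assoc, div_le_div_iff₀ (by positivity) two_pos]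
    nlinarith
  have h3 := norm_add_le (S * x * R - S * x) (S * x - x)
  rw [sub_add_sub_cancel] at h3
  linarith [h x hx]

theorem dense_coeffSpan [CompleteSpace E] (hE : IsReflexiveSpace 𝕜 E)
    (hap : HasApproximationProperty 𝕜 E) :
    Dense (coeffSpan 𝕜 E : Set (StrongDual 𝕜 (CompactAlg 𝕜 E))) := by
  intro φ
  rw [Metric.mem_closure_iff]
  intro ε hε
  obtain ⟨m, hm, h⟩ := exists_mem_coeffSpan hE φ (half_pos hε)
  refine ⟨m, hm, ?_⟩
  rw [dist_eq_norm]
  refine (ContinuousLinearMap.opNorm_le_bound _ (half_pos hε).le fun x => ?_).trans_lt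
    (half_lt_self hε)
  have hcl : IsClosed {x : CompactAlg 𝕜 E | ‖(φ - m) x‖ ≤ ε / 2 * ‖x‖} :=
    isClosed_le (φ - m).continuous.norm (continuous_const.mul continuous_norm)
  exact hcl.closure_subset_iff.2 (fun x hx => h x hx) (dense_finiteRankOps hap x)

theorem mulLeftRight_rankOne (f g : StrongDual 𝕜 E) (y z : E) :
    ContinuousLinearMap.mulLeftRight 𝕜 (CompactAlg 𝕜 E) (rankOne f y) (rankOne g z) =
      (coeffFunctional f z).smulRight (rankOne g y) := by
  ext x
  apply toCLM_injective
  ext w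
  change f (x.toCLM (g w • z)) • y = f (x.toCLM z) • g w • y
  rw [map_smul, map_smul, smul_eq_mul, mul_comm, mul_smul]

theorem mulLeftRight_mem_elementaryOps (a b : CompactAlg 𝕜 E) :
    ContinuousLinearMap.mulLeftRight 𝕜 (CompactAlg 𝕜 E) a b ∈ elementaryOps 𝕜 (CompactAlg 𝕜 E) :=
  ⟨1, fun _ => a, fun _ => b, fun x => by simp⟩

/-- For finite rank operators, membership of the image in a subspace may be checked in rank one. -/
theorem mem_of_rankOne {V : Type*} [AddCommGroup V] [Module 𝕜 V] (N : Submodule 𝕜 V)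
    (L : CompactAlg 𝕜 E →ₗ[𝕜] V) (h : ∀ f y, L (rankOne f y) ∈ N) {x : CompactAlg 𝕜 E}
    (hx : x ∈ finiteRankOps 𝕜 E) : L x ∈ N :=
  Submodule.span_le (p := N.comap L).2 (by rintro _ ⟨⟨f, y⟩, rfl⟩; exact h f y) hx

/-- For compact operators, membership of the image in a closed subspace may be checked in rank one. -/
theorem mem_of_rankOne_of_isClosed [CompleteSpace E] (hap : HasApproximationProperty 𝕜 E)
    {V : Type*} [NormedAddCommGroup V] [NormedSpace 𝕜 V] (N : Submodule 𝕜 V)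
    (hN : IsClosed (N : Set V)) (L : CompactAlg 𝕜 E →L[𝕜] V) (h : ∀ f y, L (rankOne f y) ∈ N)
    (x : CompactAlg 𝕜 E) : L x ∈ N :=
  (hN.preimage L.continuous).closure_subset_iff.2
    (fun _ hx => mem_of_rankOne N L.toLinearMap h hx) (dense_finiteRankOps hap x)

/-- Two-sided multiplication is bounded and bilinear and the compact operators are closed, so
density of finite rank operators, used in each factor, reduces to rank one. -/
theorem mulLeftRight_mem_compactOps [CompleteSpace E] (hap : HasApproximationProperty 𝕜 E)
    (a b : CompactAlg 𝕜 E) :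
    ContinuousLinearMap.mulLeftRight 𝕜 (CompactAlg 𝕜 E) a b ∈ compactOps 𝕜 (CompactAlg 𝕜 E) := by
  have hN : IsClosed ((compactOps 𝕜 (CompactAlg 𝕜 E)).toSubmodule :
      Set (CompactAlg 𝕜 E →L[𝕜] CompactAlg 𝕜 E)) :=
    isClosed_setOfPred_isCompactOperator (σ₁₂ := RingHom.id 𝕜) (M₁ := CompactAlg 𝕜 E)
      (M₂ := CompactAlg 𝕜 E)
  refine mem_of_rankOne_of_isClosed hap _ hN
    ((ContinuousLinearMap.mulLeftRight 𝕜 (CompactAlg 𝕜 E)).flip b) (fun f y => ?_) a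
  refine mem_of_rankOne_of_isClosed hap _ hN
    (ContinuousLinearMap.mulLeftRight 𝕜 (CompactAlg 𝕜 E) (rankOne f y)) (fun g z => ?_) b
  rw [mulLeftRight_rankOne]
  exact (rankOne (coeffFunctional f z) (rankOne g y)).2

theorem elementaryOps_le_compactOps [CompleteSpace E] (hap : HasApproximationProperty 𝕜 E) :
    elementaryOps 𝕜 (CompactAlg 𝕜 E) ≤ compactOps 𝕜 (CompactAlg 𝕜 E) := by
  rintro T ⟨n, a, b, hT⟩
  have : T = ∑ j, ContinuousLinearMap.mulLeftRight 𝕜 (CompactAlg 𝕜 E) (a j) (b j) := by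
    ext1 x
    rw [sum_apply]
    exact hT x
  rw [this]
  exact sum_mem fun j _ => mulLeftRight_mem_compactOps hap _ _

/-- Density of finite rank operators reduces `u` to rank one, density of `coeffSpan` reduces `φ` to
a coefficient functional, and the result is then a two-sided multiplication. -/
theorem smulRight_mem_closure_elementaryOps [CompleteSpace E] (hE : IsReflexiveSpace 𝕜 E)
    (hap : HasApproximationProperty 𝕜 E) (φ : StrongDual 𝕜 (CompactAlg 𝕜 E))
    (u : CompactAlg 𝕜 E) :
    φ.smulRight u ∈ (elementaryOps 𝕜 (CompactAlg 𝕜 E)).toSubmodule.topologicalClosure := by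
  set N := (elementaryOps 𝕜 (CompactAlg 𝕜 E)).toSubmodule.topologicalClosure with hNdef
  have hN : IsClosed (N : Set (CompactAlg 𝕜 E →L[𝕜] CompactAlg 𝕜 E)) :=
    Submodule.isClosed_topologicalClosure _
  let L := ContinuousLinearMap.smulRightL 𝕜 (CompactAlg 𝕜 E) (CompactAlg 𝕜 E)
  refine mem_of_rankOne_of_isClosed hap N hN (L φ) (fun g y => ?_) u
  have hsub : coeffSpan 𝕜 E ≤ N.comap (L.flip (rankOne g y)).toLinearMap := by
    refine Submodule.span_le.2 ?_
    rintro _ ⟨⟨f, z⟩, rfl⟩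
    refine Submodule.le_topologicalClosure _ ?_
    change (coeffFunctional f z).smulRight (rankOne g y) ∈ elementaryOps 𝕜 (CompactAlg 𝕜 E)
    rw [← mulLeftRight_rankOne]
    exact mulLeftRight_mem_elementaryOps _ _
  exact (hN.preimage (L.flip (rankOne g y)).continuous).closure_subset_iff.2 hsub
    (dense_coeffSpan hE hap φ)

/-- For rank one S and R the composite is (coefficient functional ∘ T) ⊗ rank one. Composition with
T can leave `coeffSpan`, which is why its density in the whole dual is needed. -/
theorem mulLeftRight_comp_mem_closure_elementaryOps [CompleteSpace E] (hE : IsReflexiveSpace 𝕜 E)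
    (hap : HasApproximationProperty 𝕜 E) {S R : CompactAlg 𝕜 E} (hS : S ∈ finiteRankOps 𝕜 E)
    (hR : R ∈ finiteRankOps 𝕜 E) (T : CompactAlg 𝕜 E →L[𝕜] CompactAlg 𝕜 E) :
    (ContinuousLinearMap.mulLeftRight 𝕜 (CompactAlg 𝕜 E) S R).comp T ∈
      (elementaryOps 𝕜 (CompactAlg 𝕜 E)).toSubmodule.topologicalClosure := by
  let M := ContinuousLinearMap.mulLeftRight 𝕜 (CompactAlg 𝕜 E)
  let c := (ContinuousLinearMap.compL 𝕜 (CompactAlg 𝕜 E) (CompactAlg 𝕜 E) (CompactAlg 𝕜 E)).flip T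
  refine mem_of_rankOne _ (c.comp (M.flip R)).toLinearMap (fun f y => ?_) hS
  refine mem_of_rankOne _ (c.comp (M (rankOne f y))).toLinearMap (fun g z => ?_) hR
  change (M (rankOne f y) (rankOne g z)).comp T ∈ _
  rw [mulLeftRight_rankOne]
  exact smulRight_mem_closure_elementaryOps hE hap ((coeffFunctional f z).comp T) (rankOne g y)

theorem mem_closure_elementaryOps [CompleteSpace E] (hE : IsReflexiveSpace 𝕜 E)
    (hap : HasApproximationProperty 𝕜 E) {T : CompactAlg 𝕜 E →L[𝕜] CompactAlg 𝕜 E}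
    (hT : IsCompactOperator T) :
    T ∈ (elementaryOps 𝕜 (CompactAlg 𝕜 E)).toSubmodule.topologicalClosure := by
  set N := (elementaryOps 𝕜 (CompactAlg 𝕜 E)).toSubmodule.topologicalClosure with hNdef
  have hN : IsClosed (N : Set (CompactAlg 𝕜 E →L[𝕜] CompactAlg 𝕜 E)) :=
    Submodule.isClosed_topologicalClosure _
  rw [← SetLike.mem_coe, ← hN.closure_eq, Metric.mem_closure_iff]
  intro ε hε
  have hC : IsCompact (closure (T '' Metric.closedBall 0 1)) :=
    IsCompactOperator.isCompact_closure_image_closedBall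
      (f := (T : CompactAlg 𝕜 E →ₗ[𝕜] CompactAlg 𝕜 E)) hT 1
  obtain ⟨S, hS, R, hR, h⟩ := exists_mul_mul_sub_le hE hap hC (half_pos hε)
  refine ⟨_, mulLeftRight_comp_mem_closure_elementaryOps hE hap hS hR T, ?_⟩
  rw [dist_comm, dist_eq_norm]
  refine (ContinuousLinearMap.opNorm_le_of_unit_norm (half_pos hε).le fun x hx => ?_).trans_lt
    (half_lt_self hε)
  exact h _ (subset_closure ⟨x, by simp [hx], rfl⟩)

end CompactAlg

theorem mainTheorem4 {𝕜 E : Type*} [RCLike 𝕜] [NormedAddCommGroup E] [NormedSpace 𝕜 E]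
    [CompleteSpace E] (hrefl : IsReflexiveSpace 𝕜 E) (hap : HasApproximationProperty 𝕜 E) :
    elementaryOps 𝕜 (CompactAlg 𝕜 E) ≤ compactOps 𝕜 (CompactAlg 𝕜 E) ∧
      Dense {T : CompactAlg 𝕜 (CompactAlg 𝕜 E) |
        T.toCLM ∈ elementaryOps 𝕜 (CompactAlg 𝕜 E)} := by
  refine ⟨CompactAlg.elementaryOps_le_compactOps hap, fun T => ?_⟩
  rw [Metric.mem_closure_iff]
  intro ε hε
  obtain ⟨A, hA, hd⟩ := Metric.mem_closure_iff.1
    (CompactAlg.mem_closure_elementaryOps hrefl hap T.isCompactOperator) ε hε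
  exact ⟨⟨A, CompactAlg.elementaryOps_le_compactOps hap hA⟩, hA, hd⟩
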